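/- **Setting.** Let $X$ be a metric space of doubling dimension at most $d$ (every ball can be covered by at most $2^d$ balls of half its radius). For a finite multiset $Q$ of points of $X$ let $\mathrm{opt}_{k,z}(Q)$ be the infimum of the radii $\rho\ge 0$ such that all points of $Q$ except at most $z$ outliers can be covered by $k$ balls of radius $\rho$ with centers in $X$, and let $\mathrm{diam}_z(Q)$ be the smallest diameter that can be obtained by deleting at most $z$ points from $Q$. A finite or infinite stream $p_0,p_1,\dots$ of points of $X$ has increasing arrival times $t_{\mathrm{arr}}(p_i)>0$, finitely many up to any time; $p_i$ expires at $t_{\mathrm{exp}}(p_i)=t_{\mathrm{arr}}(p_i)+W$, where $W>0$ is the window length; all arrival and expiration times are distinct; and $P(t)$ is the multiset of the $p_i$ with $t_{\mathrm{arr}}(p_i)\le t<t_{\mathrm{exp}}(p_i)$. Numbers $0<\Delta_{\min}\le\Delta_{\max}$ are known such that distinct points of the stream have distance at least $\Delta_{\min}$ and no two points of the stream have distance more than $\Delta_{\max}$; put $\sigma=\Delta_{\max}/\Delta_{\min}$. **The decision sketch.** Let $k\ge1$, $z\ge0$, and let $A$ be a $c$-approximation algorithm for the static $k$-center problem with $z$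 outliers ($c\ge1$; e.g. $c=3$). The sketch $\Gamma_{\rho,\varepsilon}$ consists of a timestamp $\tau$ (initially $0$), a set $\mathcal B$ of mini-balls of radius $\varepsilon\rho$ centered at points of the stream, a representative set $R(B)$ for every $B\in\mathcal B$, and a set $P_{\mathrm{out}}$ of outliers (initially all empty). When a stored point expires, it is deleted, together with its mini-ball if the representative set becomes empty. When $p_j$ arrives: 1. add $p_j$ to $R(B)$ for some $B\in\mathcal B$ containing it, or to $P_{\mathrm{out}}$ if there is none; 2. let $q_1,q_2,\dots$ be all points stored in representative sets and in $P_{\mathrm{out}}$, newest first, and let $i^*$ be the largest $i$ for which $A$, run on $\{q_1,\dots,q_i\}$, reports balls of radius at most $2c\rho$; put $Q^*=\{q_1,\dots,q_{i^*}\}$; 3. if $q_{i^*+1}$ exists, set $\tau:=\max(\tau,t_{\mathrm{exp}}(q_{i^*+1}))$ and remove all stored points not in $Q^*$ from the representative sets; 4. expand the balls reported for $Q^*$ by $\varepsilon\rho$ and keep exactly the mini-balls whose center lies in an expanded ball, with their representative sets; let $Z\subseteq Q^*$ be the points in no kept representative set and $Z_{\mathrm{in}}\subseteq Z$ those in an expanded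 ball; one by one, in any order, add each point of $Z_{\mathrm{in}}$ to $R(B)$ for some current mini-ball $B$ containing it, or make it the center and only representative of a new mini-ball if there is none; then reduce each $R(B)$ to its $z+1$ newest points and set $P_{\mathrm{out}}:=Z\setminus Z_{\mathrm{in}}$. The *$k$-center sketch* $\Gamma(t)$ with parameter $\varepsilon$ is the family of the sketches $\Gamma_{\rho_i,\varepsilon/2}$, $\rho_i=2^i\Delta_{\min}$, $0\le i\le\lfloor\log_2\sigma\rfloor$, at time $t$. Its storage is the total number of timestamps, mini-balls, representatives and outliers stored. **Reporting.** Let $S_i(t)$ be the multiset of all representatives and outliers in $\Gamma_{\rho_i,\varepsilon/2}$. For the $k'$-center problem, compute an optimal solution of $S_i(t)$, of radius $r_i=\mathrm{opt}_{k',z}(S_i(t))$; for the first $i$ with $t\ge\tau$ and $r_i\le2\rho_i$ report its centers with radius $r_i+\varepsilon\rho_i$, replaced by $0$ if it is less than $\Delta_{\min}$. For the diameter, report $D=\mathrm{diam}_z(S_i(t))$ for the first $i$ with $t\ge\tau$ and $D\le2\rho_i$. **Theorem.** (a) For all $d$ and $c\ge 1$ there is a constant $C$, depending only on $d$ and $c$,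 such that for all $0<\varepsilon<1$, $k\ge1$, $z\ge0$, all $X$, $A$ and streams as above, and all $t\ge0$, the sketch $\Gamma(t)$ is well defined (some run of the algorithm reaches time $t$) and, whatever choices the algorithm makes: * its storage is at most $C\,\frac{k(z+1)}{\varepsilon^d}(1+\log_2\sigma)$; * for every $1\le k'\le k$, given a subroutine that computes optimal solutions of the static $k'$-center problem with $z$ outliers, the sketch reports $k'$ balls of radius at most $(1+\varepsilon)\,\mathrm{opt}_{k',z}(P(t))$ that cover all points of $P(t)$ except at most $z$, provided that no ball of radius less than $\Delta_{\min}$ with center in $X$ contains two distinct points of the stream (this holds if all distinct points of $X$ have distance at least $\Delta_{\min}$, for instance if $X$ is the set of points of the stream, and also if distinct points of the stream have distance at least $2\Delta_{\min}$); * the sketch reports a value $D$ with $(1-2\varepsilon)\,\mathrm{diam}_z(P(t))\le D\le\mathrm{diam}_z(P(t))$. (b) For every $d$ there is a constant $C$ such that for every nonempty $X$ of doubling dimension at most $d$ and every $z\ge0$ there is a $3$-approximation $A$ for the static $1$-center problem with $z$ outliers such that, for all $0<\varepsilon<1$, all streams as above and all $t\ge0$, the $1$-center sketch with parameter $\varepsilon/4$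 that uses $A$ is well defined, has storage at most $C\,\frac{z+1}{\varepsilon^d}(1+\log_2\sigma)$, and reports a value $D$ with $D\le\mathrm{diam}_z(P(t))\le(1+\varepsilon)D$. -/

import Mathlib

noncomputable section

namespace SlidingWindow

/-! ### The static problems

A finite multiset of points of `X` is a `Multiset X`. At most `z` outliers may be dropped, so the
inliers form a sub-multiset `I ≤ Q` with `Q.card ≤ I.card + z`. Balls are closed. -/

/-- `X` has doubling dimension at most `d`: every ball can be covered by at most `2 ^ d` balls of
half its radius. -/
def HasDoublingDim (X : Type*) [MetricSpace X] (d : ℝ) : Prop :=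
  ∀ (x : X) (r : ℝ), 0 < r → ∃ s : Finset X, (s.card : ℝ) ≤ (2 : ℝ) ^ d ∧
    Metric.closedBall x r ⊆ ⋃ y ∈ s, Metric.closedBall y (r / 2)

/-- The `k` balls of radius `r` with the given centers cover all points of `Q` except for at most
`z` outliers. -/
def IsSolution {X : Type*} [MetricSpace X] {k : ℕ} (z : ℕ) (Q : Multiset X) (center : Fin k → X)
    (r : ℝ) : Prop :=
  0 ≤ r ∧ ∃ I ≤ Q, Q.card ≤ I.card + z ∧ ∀ x ∈ I, ∃ l, dist x (center l) ≤ r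

/-- The optimal radius of the `k`-center problem with `z` outliers; the centers may be arbitrary
points of `X`. -/
def opt {X : Type*} [MetricSpace X] (k z : ℕ) (Q : Multiset X) : ℝ :=
  sInf {r | ∃ center : Fin k → X, IsSolution z Q center r}

/-- The diameter with `z` outliers: the smallest diameter that remains after the deletion of `z`
points (of all points, if there are fewer than `z`). -/
def outlierDiam {X : Type*} [MetricSpace X] (z : ℕ) (Q : Multiset X) : ℝ :=
  sInf {D | ∃ I ≤ Q, Q.card ≤ I.card + z ∧ D = Metric.diam {x | x ∈ I}}

/-- A static algorithm for the `k`-center problem reports, on every finite multiset of points,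
`k` centers and a common radius. -/
abbrev Solver (X : Type*) (k : ℕ) := Multiset X → (Fin k → X) × ℝ

/-- `A` is a `c`-approximation algorithm for the `k`-center problem with `z` outliers. For `c = 1`
it computes optimal solutions. -/
def Solver.IsApprox {X : Type*} [MetricSpace X] {k : ℕ} (A : Solver X k) (z : ℕ) (c : ℝ) : Prop :=
  ∀ Q : Multiset X, IsSolution z Q (A Q).1 (A Q).2 ∧ (A Q).2 ≤ c * opt k z Q

/-! ### Streams -/

/-- A finite or infinite stream of points `pt 0, pt 1, …` of `X`, with window length `W`. The `i`-th
item arrives at time `arr i` and expires at time `arr i + W`. Only the items with `i < len` belong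
to the stream. Items are referred to by their index, so that a point may occur several times. -/
structure PointStream (X : Type*) (W : ℝ) where
  len : ℕ∞
  pt : ℕ → X
  arr : ℕ → ℝ
  arr_pos : ∀ i : ℕ, (i : ℕ∞) < len → 0 < arr i
  arr_lt : ∀ i j : ℕ, i < j → (j : ℕ∞) < len → arr i < arr j
  arr_ne : ∀ i j : ℕ, (i : ℕ∞) < len → (j : ℕ∞) < len → arr i ≠ arr j + W
  finite_arr : ∀ t : ℝ, {i : ℕ | (i : ℕ∞) < len ∧ arr i ≤ t}.Finite

namespace PointStream

variable {X : Type*} {W : ℝ} (P : PointStream X W)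

/-- The expiration time of an item. -/
def expire (i : ℕ) : ℝ := P.arr i + W

/-- The multiset of points at a finite set of items. -/
def points (S : Finset ℕ) : Multiset X := S.val.map P.pt

/-- The items in the window at time `t`: those with `arr i ≤ t < expire i`. -/
def windowItems (t : ℝ) : Finset ℕ := (P.finite_arr t).toFinset.filter fun i => t < P.expire i

/-- The multiset of points in the window at time `t`. -/
def window (t : ℝ) : Multiset X := P.points (P.windowItems t)

/-- The times at which some item arrives or expires. -/
def eventTimes : Set ℝ := {s | ∃ i : ℕ, (i : ℕ∞) < P.len ∧ (s = P.arr i ∨ s = P.expire i)}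

/-- Distinct points of the stream have distance at least `Δmin`, and no distance between points of
the stream exceeds `Δmax`. -/
def DistBounds [MetricSpace X] (Δmin Δmax : ℝ) : Prop :=
  ∀ i j : ℕ, (i : ℕ∞) < P.len → (j : ℕ∞) < P.len →
    (P.pt i ≠ P.pt j → Δmin ≤ dist (P.pt i) (P.pt j)) ∧ dist (P.pt i) (P.pt j) ≤ Δmax

/-- No ball of radius less than `Δmin`, centered anywhere in `X`, contains two distinct points of
the stream. This holds if any two distinct points of `X` have distance at least `Δmin`, in
particular if `X` consists of the points of the stream; it also holds in every metric space if any
two distinct points of the stream have distance at least `2 * Δmin`. -/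
def CentersSeparated [MetricSpace X] (Δmin : ℝ) : Prop :=
  ∀ (x : X) (i j : ℕ), (i : ℕ∞) < P.len → (j : ℕ∞) < P.len →
    P.pt i ≠ P.pt j → Δmin ≤ max (dist x (P.pt i)) (dist x (P.pt j))

end PointStream

/-! ### The sketch for the decision problem -/

/-- A sketch: a timestamp `τ`, a set of mini-balls (each given by the item at its center), the
representative set of each mini-ball, and a set of outliers. -/
structure Sketch where
  τ : ℝ
  balls : Finset ℕ
  rep : ℕ → Finset ℕ
  out : Finset ℕ

namespace Sketch

/-- The sketch before the first arrival. -/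
def empty : Sketch := ⟨0, ∅, fun _ => ∅, ∅⟩

/-- All items that are stored in representative sets or as outliers. -/
def items (Γ : Sketch) : Finset ℕ := Γ.out ∪ Γ.balls.biUnion Γ.rep

/-- Storage: the timestamp, the centers of the mini-balls, the representatives and the outliers. -/
def storage (Γ : Sketch) : ℕ :=
  1 + Γ.balls.card + (∑ b ∈ Γ.balls, (Γ.rep b).card) + Γ.out.card

/-- The departure of item `j`: it is deleted, and a mini-ball whose representative set becomes
empty by this deletion is removed. -/
def depart (Γ : Sketch) (j : ℕ) : Sketch where
  τ := Γ.τ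
  balls := Γ.balls.filter fun b => Γ.rep b ≠ {j}
  rep := fun b => (Γ.rep b).erase j
  out := Γ.out.erase j

end Sketch

/-- The items of `Q` in the order of decreasing arrival time. -/
def newestFirst (Q : Finset ℕ) : List ℕ := Q.sort (· ≥ ·)

/-- The `i` items of `Q` that arrived last. -/
def newest (Q : Finset ℕ) (i : ℕ) : Finset ℕ := ((newestFirst Q).take i).toFinset

section Update

variable {X : Type*} [MetricSpace X] {W : ℝ} {k : ℕ}

/-- First step of the arrival of item `j`, for mini-balls of radius `s`: `j` is added to the
representative set of some mini-ball that contains it, or to the outliers if there is none. -/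
def InsertItem (P : PointStream X W) (s : ℝ) (Γ : Sketch) (j : ℕ) (Γ' : Sketch) : Prop :=
  (∃ b ∈ Γ.balls, dist (P.pt j) (P.pt b) ≤ s ∧
    Γ' = { Γ with rep := Function.update Γ.rep b (insert j (Γ.rep b)) }) ∨
  ((∀ b ∈ Γ.balls, s < dist (P.pt j) (P.pt b)) ∧ Γ' = { Γ with out := insert j Γ.out })

/-- `Distribute P s l balls rep balls' rep'`: the items of `l` are handled one by one; each is added
to the representative set of some current mini-ball that contains it, and if there is none, it
becomes the center of a new mini-ball of radius `s`. -/
inductive Distribute (P : PointStream X W) (s : ℝ) :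
    List ℕ → Finset ℕ → (ℕ → Finset ℕ) → Finset ℕ → (ℕ → Finset ℕ) → Prop
  | nil (balls : Finset ℕ) (rep : ℕ → Finset ℕ) : Distribute P s [] balls rep balls rep
  | join (q : ℕ) (l : List ℕ) (balls balls' : Finset ℕ) (rep rep' : ℕ → Finset ℕ) (b : ℕ) :
      b ∈ balls → dist (P.pt q) (P.pt b) ≤ s →
      Distribute P s l balls (Function.update rep b (insert q (rep b))) balls' rep' →
      Distribute P s (q :: l) balls rep balls' rep'
  | create (q : ℕ) (l : List ℕ) (balls balls' : Finset ℕ) (rep rep' : ℕ → Finset ℕ) :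
      (∀ b ∈ balls, s < dist (P.pt q) (P.pt b)) →
      Distribute P s l (insert q balls) (Function.update rep q {q}) balls' rep' →
      Distribute P s (q :: l) balls rep balls' rep'

/-- The mini-balls of `Γ` whose center lies in one of the `k` balls `sol`, expanded by `s`. -/
def keptBalls (P : PointStream X W) (s : ℝ) (Γ : Sketch) (sol : (Fin k → X) × ℝ) : Finset ℕ :=
  Γ.balls.filter fun b => ∃ l, dist (P.pt b) (sol.1 l) ≤ sol.2 + s

/-- The representative sets of the kept mini-balls, restricted to the items of `Qi`. -/
def keptRep (P : PointStream X W) (s : ℝ) (Γ : Sketch) (sol : (Fin k → X) × ℝ) (Qi : Finset ℕ)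
    (b : ℕ) : Finset ℕ :=
  if b ∈ keptBalls P s Γ sol then Γ.rep b ∩ Qi else ∅

/-- The items of `Qi` that are in no kept representative set. -/
def leftover (P : PointStream X W) (s : ℝ) (Γ : Sketch) (sol : (Fin k → X) × ℝ) (Qi : Finset ℕ) :
    Finset ℕ :=
  Qi \ (keptBalls P s Γ sol).biUnion (keptRep P s Γ sol Qi)

/-- The leftover items that lie in one of the expanded balls. -/
def leftoverIn (P : PointStream X W) (s : ℝ) (Γ : Sketch) (sol : (Fin k → X) × ℝ)
    (Qi : Finset ℕ) : Finset ℕ :=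
  (leftover P s Γ sol Qi).filter fun q => ∃ l, dist (P.pt q) (sol.1 l) ≤ sol.2 + s

/-- The update of the sketch `Γ` with parameters `ρ` and `ε` to `Γ'` when item `j` arrives. `A` is
the `c`-approximation algorithm for the static problem that is used as a subroutine (`c = 3`, and
hence the threshold `6 * ρ`, for the algorithm of Charikar et al.); it is run on the `i` newest items
of the sketch, for the largest `i` for which it reports a radius of at most `2 * c * ρ`. All choices
that the algorithm leaves open are arbitrary. -/
def HandleArrival (P : PointStream X W) (z : ℕ) (A : Solver X k) (c ρ ε : ℝ)
    (Γ : Sketch) (j : ℕ) (Γ' : Sketch) : Prop :=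
  ∃ (Γ₁ : Sketch) (i : ℕ) (l : List ℕ) (rep₂ : ℕ → Finset ℕ),
    InsertItem P (ε * ρ) Γ j Γ₁ ∧
    IsGreatest {i | i ≤ Γ₁.items.card ∧ (A (P.points (newest Γ₁.items i))).2 ≤ 2 * c * ρ} i ∧
    (Γ'.τ = match (newestFirst Γ₁.items)[i]? with
      | some q => max Γ.τ (P.expire q)
      | none => Γ.τ) ∧
    let Qi := newest Γ₁.items i
    let sol := A (P.points Qi)
    l.Nodup ∧ l.toFinset = leftoverIn P (ε * ρ) Γ₁ sol Qi ∧
    Distribute P (ε * ρ) l (keptBalls P (ε * ρ) Γ₁ sol) (keptRep P (ε * ρ) Γ₁ sol Qi)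
      Γ'.balls rep₂ ∧
    (Γ'.rep = fun b => newest (rep₂ b) (z + 1)) ∧
    Γ'.out = leftover P (ε * ρ) Γ₁ sol Qi \ leftoverIn P (ε * ρ) Γ₁ sol Qi

/-- `SketchAt P z A c ρ ε t Γ`: the algorithm with parameters `ρ` and `ε` can be in state `Γ` at time
`t`. It starts at time `0` with the empty sketch, handles the arrivals and departures of the stream
in the order of time, and does nothing in between. -/
inductive SketchAt (P : PointStream X W) (z : ℕ) (A : Solver X k) (c ρ ε : ℝ) :
    ℝ → Sketch → Prop
  | start : SketchAt P z A c ρ ε 0 Sketch.empty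
  | wait (s t : ℝ) (Γ : Sketch) : SketchAt P z A c ρ ε s Γ → s ≤ t →
      (∀ u ∈ P.eventTimes, u ∉ Set.Ioc s t) → SketchAt P z A c ρ ε t Γ
  | arrive (s : ℝ) (Γ Γ' : Sketch) (j : ℕ) : SketchAt P z A c ρ ε s Γ → (j : ℕ∞) < P.len →
      s < P.arr j → (∀ u ∈ P.eventTimes, u ∉ Set.Ioo s (P.arr j)) →
      HandleArrival P z A c ρ ε Γ j Γ' → SketchAt P z A c ρ ε (P.arr j) Γ'
  | depart (s : ℝ) (Γ : Sketch) (j : ℕ) : SketchAt P z A c ρ ε s Γ → (j : ℕ∞) < P.len →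
      s < P.expire j → (∀ u ∈ P.eventTimes, u ∉ Set.Ioo s (P.expire j)) →
      SketchAt P z A c ρ ε (P.expire j) (Γ.depart j)

end Update

/-! ### The sketch for the optimization problem, and the reported solutions -/

/-- The number of decision sketches: one for each `0 ≤ i ≤ ⌊log₂ (Δmax / Δmin)⌋`. -/
def levels (Δmin Δmax : ℝ) : ℕ := ⌊Real.logb 2 (Δmax / Δmin)⌋₊ + 1

section Report

variable {X : Type*} [MetricSpace X] {W : ℝ} {k : ℕ}

/-- The family `Γ` is a possible state at time `t` of the sketch with parameter `ε`: its `i`-th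
member is a state of the decision sketch with parameters `2 ^ i * Δmin` and `ε / 2`. -/
def IsFullSketch (P : PointStream X W) (z : ℕ) (A : Solver X k) (c Δmin Δmax ε t : ℝ)
    (Γ : Fin (levels Δmin Δmax) → Sketch) : Prop :=
  ∀ i : Fin (levels Δmin Δmax), SketchAt P z A c (2 ^ (i : ℕ) * Δmin) (ε / 2) t (Γ i)

/-- The total storage of a family of sketches. -/
def totalStorage {n : ℕ} (Γ : Fin n → Sketch) : ℕ := ∑ i, (Γ i).storage

/-- The decision algorithm for the `k`-center problem, with static solver `solve`; `none` means that
it reports NO. -/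
def tryToCover (P : PointStream X W) (solve : Solver X k) (ρ ε t : ℝ) (Γ : Sketch) :
    Option ((Fin k → X) × ℝ) :=
  let sol := solve (P.points Γ.items)
  if t < Γ.τ ∨ 2 * ρ < sol.2 then none else some (sol.1, sol.2 + 2 * ε * ρ)

/-- The first answer of the decision algorithm other than NO; radii below `Δmin` are reduced to
zero. -/
def findApproximateCenters {n : ℕ} (P : PointStream X W) (solve : Solver X k) (Δmin ε t : ℝ)
    (Γ : Fin n → Sketch) : Option ((Fin k → X) × ℝ) :=
  ((List.finRange n).findSome? fun i : Fin n =>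
    tryToCover P solve (2 ^ (i : ℕ) * Δmin) (ε / 2) t (Γ i)).map fun ans =>
      if ans.2 < Δmin then (ans.1, 0) else ans

/-- The decision algorithm for the diameter with `z` outliers. -/
def tryDiameter (P : PointStream X W) (z : ℕ) (ρ t : ℝ) (Γ : Sketch) : Option ℝ :=
  let D := outlierDiam z (P.points Γ.items)
  if t < Γ.τ ∨ 2 * ρ < D then none else some D

/-- The first answer of the decision algorithm for the diameter other than NO. -/
def findDiameter {n : ℕ} (P : PointStream X W) (z : ℕ) (Δmin t : ℝ) (Γ : Fin n → Sketch) :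
    Option ℝ :=
  (List.finRange n).findSome? fun i : Fin n => tryDiameter P z (2 ^ (i : ℕ) * Δmin) t (Γ i)

end Report

end SlidingWindow

end

open SlidingWindow

namespace SlidingWindow

/-! A decision sketch at scale `ρ` is correct because of one invariant, `Represents`: every window
point is stored, or expires no later than the timestamp, or shares a mini-ball with more than `z`
stored representatives, all newer than itself. `HandleArrival.represents` shows that an arrival
preserves it. More than `z` representatives cannot all be outliers of the solution reported for
`Q*`, so one of them lies in a reported ball, and the expansion by the mini-ball radius captures the
center: a full mini-ball inside `Q*` is never discarded. If instead some representative is cut off,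
the timestamp is raised past its expiration, hence past that of the older point. "Newer" also makes
departures harmless, since the oldest point leaves first.

The timestamp never blocks a query without cause (`TimestampJustified`): when `A` exceeds `2 * c *
ρ` on some newest items, their optimum exceeds `2 * ρ`, and all of them are still alive while the
timestamp lies in the future.

For storage, mini-ball centers are pairwise more than the mini-ball radius apart and lie near `k`
points, so doubling bounds their number (`HasDoublingDim.card_le_of_separated`); each carries at
most `z + 1` representatives, and there are at most `z` outliers.

For a query with `τ ≤ t`, an unstored window point has more than `z` stored points within two
mini-ball radii. Any solution for the stored points keeps one of them as an inlier, so the point is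
served at an additive cost proportional to `ε * ρ`. Stored points form a subset of the window, which
gives the opposite inequality. The additive cost is relative because the level below the first
accepted one was rejected, for either reason forcing the true value up to the current `ρ`; at level
zero, separation forces a value below `Δmin` to be zero. The top level always accepts since `Δmax ≤
2 * ρ` there. -/

open scoped Classical in
/-- The items of `T` that lie in none of the balls of radius `r` with the given centers. -/
noncomputable def uncovered {X : Type*} [MetricSpace X] {W : ℝ} {k : ℕ} (P : PointStream X W)
    (T : Finset ℕ) (center : Fin k → X) (r : ℝ) : Finset ℕ :=
  T.filter fun i => ¬ ∃ l, dist (P.pt i) (center l) ≤ r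

/-! ### Sub-multisets of points as sets of items -/

section Points

variable {X : Type*} {W : ℝ} {P : PointStream X W}

theorem card_points (T : Finset ℕ) : (P.points T).card = T.card := by
  simp [PointStream.points]

theorem mem_points {T : Finset ℕ} {x : X} : x ∈ P.points T ↔ ∃ i ∈ T, P.pt i = x := by
  simp [PointStream.points]

theorem points_mono {S T : Finset ℕ} (h : S ⊆ T) : P.points S ≤ P.points T :=
  Multiset.map_le_map (Finset.val_le_iff.mpr h)

/-- Points may repeat, so a sub-multiset does not determine its items. Some choice exists because a
sublist of a mapped list is the image of a sublist. Outliers can thereafter be counted as items. -/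
theorem exists_points_eq {T : Finset ℕ} {I : Multiset X} (h : I ≤ P.points T) :
    ∃ F ⊆ T, I = P.points F := by
  induction I using Quotient.inductionOn with | _ l =>
  have h' : (l : Multiset X) ≤ ((T.toList.map P.pt : List X) : Multiset X) := by
    rw [← Multiset.map_coe, Finset.coe_toList]; exact h
  obtain ⟨l₁, hp, hs⟩ := Multiset.coe_le.mp h'
  obtain ⟨l₂, hs₂, rfl⟩ := List.sublist_map_iff.mp hs
  refine ⟨l₂.toFinset, fun x hx => ?_, ?_⟩
  · exact Finset.mem_toList.mp (hs₂.subset (List.mem_toFinset.mp hx))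
  · have hn : l₂.Nodup := hs₂.nodup T.nodup_toList
    have : l₂.toFinset.val = (l₂ : Multiset ℕ) := by
      rw [List.toFinset_val, hn.dedup]
    rw [PointStream.points, this, Multiset.map_coe]
    exact (Multiset.coe_eq_coe.mpr hp).symm

end Points

/-! ### Optimal radius and diameter with outliers -/

section Static

variable {X : Type*} [MetricSpace X] {W : ℝ} {k z : ℕ} {P : PointStream X W}

theorem mem_uncovered {T : Finset ℕ} {center : Fin k → X} {r : ℝ} {i : ℕ} :
    i ∈ uncovered P T center r ↔ i ∈ T ∧ ¬ ∃ l, dist (P.pt i) (center l) ≤ r := by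
  simp only [uncovered, Finset.mem_filter]

/-- The largest admissible inlier set consists of everything the balls cover, so only the uncovered
items need counting. -/
theorem isSolution_points_iff {T : Finset ℕ} {center : Fin k → X} {r : ℝ} :
    IsSolution z (P.points T) center r ↔ 0 ≤ r ∧ (uncovered P T center r).card ≤ z := by
  classical
  have hsplit : (T.filter fun i => ∃ l, dist (P.pt i) (center l) ≤ r).card +
      (uncovered P T center r).card = T.card := by
    rw [uncovered]
    convert Finset.card_filter_add_card_filter_not (s := T)
      (fun i => ∃ l, dist (P.pt i) (center l) ≤ r)
  refine and_congr_right fun _ => ⟨?_, fun h => ?_⟩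
  · rintro ⟨I, hI, hc, hcov⟩
    obtain ⟨F, hF, rfl⟩ := exists_points_eq hI
    rw [card_points, card_points] at hc
    have : F ⊆ T.filter fun i => ∃ l, dist (P.pt i) (center l) ≤ r := fun i hi =>
      Finset.mem_filter.mpr ⟨hF hi, hcov _ (mem_points.mpr ⟨i, hi, rfl⟩)⟩
    have := Finset.card_le_card this
    omega
  · refine ⟨P.points (T.filter fun i => ∃ l, dist (P.pt i) (center l) ≤ r),
      points_mono (Finset.filter_subset _ _), ?_, ?_⟩
    · rw [card_points, card_points]; omega
    · intro x hx
      obtain ⟨i, hi, rfl⟩ := mem_points.mp hx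
      exact (Finset.mem_filter.mp hi).2

theorem uncovered_mono {S T : Finset ℕ} (h : S ⊆ T) (center : Fin k → X) (r : ℝ) :
    uncovered P S center r ⊆ uncovered P T center r := fun _ hi =>
  mem_uncovered.mpr ⟨h (mem_uncovered.mp hi).1, (mem_uncovered.mp hi).2⟩

theorem IsSolution.points_subset {S T : Finset ℕ} (h : S ⊆ T) {center : Fin k → X} {r : ℝ}
    (hT : IsSolution z (P.points T) center r) : IsSolution z (P.points S) center r := by
  rw [isSolution_points_iff] at *
  exact ⟨hT.1, (Finset.card_le_card (uncovered_mono h center r)).trans hT.2⟩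

theorem opt_bddBelow (Q : Multiset X) :
    BddBelow {r | ∃ center : Fin k → X, IsSolution z Q center r} :=
  ⟨0, fun _ ⟨_, h⟩ => h.1⟩

theorem opt_nonneg (k z : ℕ) (Q : Multiset X) : 0 ≤ opt k z Q :=
  Real.sInf_nonneg fun _ ⟨_, h⟩ => h.1

theorem IsSolution.opt_le {Q : Multiset X} {center : Fin k → X} {r : ℝ}
    (h : IsSolution z Q center r) : opt k z Q ≤ r :=
  csInf_le (opt_bddBelow Q) ⟨center, h⟩

theorem exists_isSolution [Nonempty X] (hk : 1 ≤ k) (z : ℕ) (Q : Multiset X) :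
    ∃ (center : Fin k → X) (r : ℝ), IsSolution z Q center r := by
  obtain ⟨x⟩ := ‹Nonempty X›
  have hfin : {y | y ∈ Q}.Finite := Q.finite_toSet
  obtain ⟨r, hr⟩ := (hfin.image fun y => dist y x).bddAbove
  exact ⟨fun _ => x, max r 0, le_max_right _ _, Q, le_rfl, Nat.le_add_right _ _, fun y hy =>
    ⟨⟨0, hk⟩, (hr ⟨y, hy, rfl⟩).trans (le_max_left _ _)⟩⟩

/-- With centers anywhere in `X` the infimum need not be attained; this replaces an optimal
solution. -/
theorem exists_isSolution_lt [Nonempty X] (hk : 1 ≤ k) {Q : Multiset X} {a : ℝ}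
    (h : opt k z Q < a) : ∃ (center : Fin k → X) (r : ℝ), IsSolution z Q center r ∧ r < a := by
  obtain ⟨center, r, hr⟩ := exists_isSolution (X := X) hk z Q
  obtain ⟨r', ⟨c', h'⟩, hlt⟩ := exists_lt_of_csInf_lt
    (s := {r | ∃ center : Fin k → X, IsSolution z Q center r}) ⟨r, center, hr⟩ h
  exact ⟨c', r', h', hlt⟩

theorem le_opt [Nonempty X] (hk : 1 ≤ k) {Q : Multiset X} {a : ℝ}
    (h : ∀ (center : Fin k → X) (r : ℝ), IsSolution z Q center r → a ≤ r) : a ≤ opt k z Q := by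
  by_contra! hlt
  obtain ⟨center, r, hr, hra⟩ := exists_isSolution_lt hk hlt
  exact absurd (h center r hr) (not_le.mpr hra)

theorem opt_points_mono [Nonempty X] (hk : 1 ≤ k) {S T : Finset ℕ} (h : S ⊆ T) :
    opt k z (P.points S) ≤ opt k z (P.points T) :=
  le_opt hk fun _ _ hr => (hr.points_subset h).opt_le

theorem opt_anti [Nonempty X] {k' : ℕ} (hk' : 1 ≤ k') (h : k' ≤ k) (Q : Multiset X) :
    opt k z Q ≤ opt k' z Q := by
  refine le_opt hk' fun center r ⟨h0, I, hI, hc, hcov⟩ => ?_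
  -- The surplus centers repeat center `0`.
  refine IsSolution.opt_le (center := fun l : Fin k =>
    if hl : (l : ℕ) < k' then center ⟨l, hl⟩ else center ⟨0, hk'⟩) ⟨h0, I, hI, hc, fun x hx => ?_⟩
  obtain ⟨l, hl⟩ := hcov x hx
  exact ⟨⟨l, l.2.trans_le h⟩, by simpa using hl⟩

/-- Unlike for `opt`, the infimum ranges over finitely many sub-multisets, so it is attained. -/
theorem exists_outlierDiam_eq (z : ℕ) (Q : Multiset X) :
    ∃ I ≤ Q, Q.card ≤ I.card + z ∧ outlierDiam z Q = Metric.diam {x | x ∈ I} := by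
  have hfin : {D | ∃ I ≤ Q, Q.card ≤ I.card + z ∧ D = Metric.diam {x | x ∈ I}}.Finite := by
    classical
    refine (Q.powerset.toFinset.image fun I => Metric.diam {x | x ∈ I}).finite_toSet.subset ?_
    rintro D ⟨I, hI, -, rfl⟩
    exact Finset.mem_coe.mpr (Finset.mem_image.mpr ⟨I, by simpa using hI, rfl⟩)
  have hne : {D | ∃ I ≤ Q, Q.card ≤ I.card + z ∧ D = Metric.diam {x | x ∈ I}}.Nonempty :=
    ⟨_, Q, le_rfl, Nat.le_add_right _ _, rfl⟩
  exact hne.csInf_mem hfin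

theorem outlierDiam_nonneg (z : ℕ) (Q : Multiset X) : 0 ≤ outlierDiam z Q := by
  obtain ⟨I, -, -, h⟩ := exists_outlierDiam_eq z Q
  exact h ▸ Metric.diam_nonneg

theorem exists_dist_le_outlierDiam (z : ℕ) (Q : Multiset X) :
    ∃ I ≤ Q, Q.card ≤ I.card + z ∧ ∀ x ∈ I, ∀ y ∈ I, dist x y ≤ outlierDiam z Q := by
  obtain ⟨I, hI, hc, h⟩ := exists_outlierDiam_eq z Q
  refine ⟨I, hI, hc, fun x hx y hy => h ▸ ?_⟩
  exact Metric.dist_le_diam_of_mem I.finite_toSet.isBounded hx hy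

theorem outlierDiam_le {Q I : Multiset X} (hI : I ≤ Q) (hc : Q.card ≤ I.card + z) {D : ℝ}
    (hD : 0 ≤ D) (h : ∀ x ∈ I, ∀ y ∈ I, dist x y ≤ D) : outlierDiam z Q ≤ D :=
  (csInf_le (s := {D | ∃ I ≤ Q, Q.card ≤ I.card + z ∧ D = Metric.diam {x | x ∈ I}})
    ⟨0, by rintro _ ⟨_, -, -, rfl⟩; exact Metric.diam_nonneg⟩ ⟨I, hI, hc, rfl⟩).trans
    (Metric.diam_le_of_forall_dist_le hD h)

theorem exists_items_dist_le_outlierDiam (z : ℕ) (T : Finset ℕ) :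
    ∃ F ⊆ T, T.card ≤ F.card + z ∧
      ∀ i ∈ F, ∀ j ∈ F, dist (P.pt i) (P.pt j) ≤ outlierDiam z (P.points T) := by
  obtain ⟨I, hI, hc, h⟩ := exists_dist_le_outlierDiam z (P.points T)
  obtain ⟨F, hF, rfl⟩ := exists_points_eq hI
  rw [card_points, card_points] at hc
  exact ⟨F, hF, hc, fun i hi j hj => h _ (mem_points.mpr ⟨i, hi, rfl⟩) _
    (mem_points.mpr ⟨j, hj, rfl⟩)⟩

theorem outlierDiam_points_le {F T : Finset ℕ} (hF : F ⊆ T) (hc : T.card ≤ F.card + z) {D : ℝ}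
    (hD : 0 ≤ D) (h : ∀ i ∈ F, ∀ j ∈ F, dist (P.pt i) (P.pt j) ≤ D) :
    outlierDiam z (P.points T) ≤ D := by
  refine outlierDiam_le (points_mono hF) (by rwa [card_points, card_points]) hD ?_
  intro x hx y hy
  obtain ⟨i, hi, rfl⟩ := mem_points.mp hx
  obtain ⟨j, hj, rfl⟩ := mem_points.mp hy
  exact h i hi j hj

theorem outlierDiam_points_mono {S T : Finset ℕ} (h : S ⊆ T) :
    outlierDiam z (P.points S) ≤ outlierDiam z (P.points T) := by
  obtain ⟨F, hF, hc, hd⟩ := exists_items_dist_le_outlierDiam (P := P) z T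
  refine outlierDiam_points_le (F := F ∩ S) Finset.inter_subset_right ?_ (outlierDiam_nonneg _ _)
    fun i hi j hj => hd i (Finset.mem_inter.mp hi).1 j (Finset.mem_inter.mp hj).1
  have h1 := Finset.card_sdiff_add_card_inter S F
  have h2 : (S \ F).card ≤ (T \ F).card := Finset.card_le_card (Finset.sdiff_subset_sdiff h le_rfl)
  have h3 := Finset.card_sdiff_add_card_eq_card hF
  rw [Finset.inter_comm]
  omega

/-- An inlier set of minimal diameter is covered by a ball around one of its points. -/
theorem exists_isSolution_outlierDiam [Nonempty X] (hk : 1 ≤ k) (z : ℕ) (Q : Multiset X) :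
    ∃ center : Fin k → X, IsSolution z Q center (outlierDiam z Q) := by
  obtain ⟨I, hI, hc, h⟩ := exists_dist_le_outlierDiam z Q
  obtain ⟨x, hx⟩ : ∃ x : X, ∀ y ∈ I, dist y x ≤ outlierDiam z Q := by
    by_cases hne : ∃ x, x ∈ I
    · obtain ⟨x, hx⟩ := hne
      exact ⟨x, fun y hy => h y hy x hx⟩
    · obtain ⟨x⟩ := ‹Nonempty X›
      exact ⟨x, fun y hy => absurd ⟨y, hy⟩ hne⟩
  exact ⟨fun _ => x, outlierDiam_nonneg _ _, I, hI, hc, fun y hy => ⟨⟨0, hk⟩, hx y hy⟩⟩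

theorem opt_le_outlierDiam [Nonempty X] (hk : 1 ≤ k) (z : ℕ) (Q : Multiset X) :
    opt k z Q ≤ outlierDiam z Q :=
  (exists_isSolution_outlierDiam hk z Q).choose_spec.opt_le

theorem outlierDiam_le_two_mul_opt [Nonempty X] (z : ℕ) (Q : Multiset X) :
    outlierDiam z Q ≤ 2 * opt 1 z Q := by
  suffices outlierDiam z Q / 2 ≤ opt 1 z Q by linarith
  refine le_opt le_rfl fun center r ⟨h0, I, hI, hc, hcov⟩ => ?_
  have : outlierDiam z Q ≤ 2 * r := by
    refine outlierDiam_le hI hc (by linarith) fun x hx y hy => ?_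
    obtain ⟨l, hl⟩ := hcov x hx
    obtain ⟨m, hm⟩ := hcov y hy
    obtain rfl : l = m := Subsingleton.elim _ _
    linarith [dist_triangle_right x y (center l)]
  linarith

/-- A ball around an inlier with the outlier diameter as radius is even a 2-approximation, because
inliers in a ball of radius `r` are at most `2 * r` apart. -/
theorem exists_solver_isApprox [Nonempty X] (z : ℕ) : ∃ A : Solver X 1, A.IsApprox z 3 := by
  choose center h using fun Q : Multiset X => exists_isSolution_outlierDiam (k := 1) le_rfl z Q
  refine ⟨fun Q => (center Q, outlierDiam z Q), fun Q => ⟨h Q, ?_⟩⟩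
  linarith [outlierDiam_le_two_mul_opt z Q, opt_nonneg 1 z Q]

variable {Δmin Δmax : ℝ}

theorem opt_le_of_distBounds [Nonempty X] (hk : 1 ≤ k) (hΔ : 0 ≤ Δmax)
    (hP : P.DistBounds Δmin Δmax) {T : Finset ℕ} (hT : ∀ i ∈ T, (i : ℕ∞) < P.len) :
    opt k z (P.points T) ≤ Δmax :=
  (opt_le_outlierDiam hk z _).trans (outlierDiam_points_le (subset_refl T) (Nat.le_add_right _ _) hΔ
    fun i hi j hj => (hP i j (hT i hi) (hT j hj)).2)

theorem outlierDiam_le_of_distBounds (hΔ : 0 ≤ Δmax)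
    (hP : P.DistBounds Δmin Δmax) {T : Finset ℕ} (hT : ∀ i ∈ T, (i : ℕ∞) < P.len) :
    outlierDiam z (P.points T) ≤ Δmax :=
  outlierDiam_points_le (subset_refl T) (Nat.le_add_right _ _) hΔ
    fun i hi j hj => (hP i j (hT i hi) (hT j hj)).2

theorem outlierDiam_eq_zero_of_lt (hP : P.DistBounds Δmin Δmax) {T : Finset ℕ}
    (hT : ∀ i ∈ T, (i : ℕ∞) < P.len) (h : outlierDiam z (P.points T) < Δmin) :
    outlierDiam z (P.points T) = 0 := by
  obtain ⟨F, hF, hc, hd⟩ := exists_items_dist_le_outlierDiam (P := P) z T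
  refine le_antisymm (outlierDiam_points_le hF hc le_rfl fun i hi j hj => ?_)
    (outlierDiam_nonneg _ _)
  by_contra! hpos
  have := (hP i j (hT i (hF hi)) (hT j (hF hj))).1 (dist_pos.mp hpos)
  linarith [hd i hi j hj]

/-- A ball of radius below `Δmin` meets the stream in a single location; recentering it there allows
radius zero. -/
theorem opt_eq_zero_of_lt [Nonempty X] (hk : 1 ≤ k) (hP : P.CentersSeparated Δmin) {T : Finset ℕ}
    (hT : ∀ i ∈ T, (i : ℕ∞) < P.len) (h : opt k z (P.points T) < Δmin) :
    opt k z (P.points T) = 0 := by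
  refine le_antisymm ?_ (opt_nonneg _ _ _)
  obtain ⟨center, r, hsol, hr⟩ := exists_isSolution_lt hk h
  have key : ∀ l, ∃ x : X, ∀ i ∈ T, dist (P.pt i) (center l) ≤ r → P.pt i = x := by
    intro l
    by_cases hne : ∃ i ∈ T, dist (P.pt i) (center l) ≤ r
    · obtain ⟨i, hi, hd⟩ := hne
      refine ⟨P.pt i, fun j hj hd' => ?_⟩
      by_contra hij
      have := hP (center l) j i (hT j hj) (hT i hi) hij
      rw [dist_comm _ (P.pt j), dist_comm _ (P.pt i)] at this
      exact absurd this (not_le.mpr (max_lt (hd'.trans_lt hr) (hd.trans_lt hr)))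
    · exact ⟨center l, fun i hi hd => absurd ⟨i, hi, hd⟩ hne⟩
  choose x hx using key
  refine IsSolution.opt_le (center := x) (isSolution_points_iff.mpr ⟨le_rfl, ?_⟩)
  refine (Finset.card_le_card fun i hi => ?_).trans (isSolution_points_iff.mp hsol).2
  obtain ⟨hiT, hn⟩ := mem_uncovered.mp hi
  refine mem_uncovered.mpr ⟨hiT, fun ⟨l, hl⟩ => hn ⟨l, ?_⟩⟩
  rw [hx l i hiT hl, dist_self]

end Static

/-! ### Packing in doubling spaces -/

section Doubling

variable {X : Type*} [MetricSpace X] {d : ℝ}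

theorem HasDoublingDim.nonneg [Nonempty X] (h : HasDoublingDim X d) : 0 ≤ d := by
  obtain ⟨x⟩ := ‹Nonempty X›
  obtain ⟨s, hs, hcov⟩ := h x 1 one_pos
  obtain ⟨y, hy, -⟩ := Set.mem_iUnion₂.mp (hcov (Metric.mem_closedBall_self zero_le_one))
  have : (1 : ℝ) ≤ s.card := by exact_mod_cast Finset.card_pos.mpr ⟨y, hy⟩
  by_contra! hd
  linarith [Real.rpow_lt_one_of_one_lt_of_neg one_lt_two hd]

theorem HasDoublingDim.exists_cover (h : HasDoublingDim X d) (m : ℕ) (x : X) {r : ℝ} (hr : 0 < r) :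
    ∃ s : Finset X, (s.card : ℝ) ≤ ((2 : ℝ) ^ d) ^ m ∧
      Metric.closedBall x r ⊆ ⋃ y ∈ s, Metric.closedBall y (r / 2 ^ m) := by
  classical
  induction m with
  | zero => exact ⟨{x}, by simp, by simp⟩
  | succ m ih =>
    obtain ⟨s, hs, hcov⟩ := ih
    choose f hf hfc using fun y => h y (r / 2 ^ m) (by positivity)
    refine ⟨s.biUnion f, ?_, fun p hp => ?_⟩
    · calc ((s.biUnion f).card : ℝ) ≤ ∑ y ∈ s, ((f y).card : ℝ) := by
            exact_mod_cast Finset.card_biUnion_le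
        _ ≤ ∑ _y ∈ s, (2 : ℝ) ^ d := Finset.sum_le_sum fun y _ => hf y
        _ = s.card * (2 : ℝ) ^ d := by simp
        _ ≤ ((2 : ℝ) ^ d) ^ m * (2 : ℝ) ^ d := by gcongr
        _ = _ := (pow_succ _ _).symm
    · obtain ⟨y, hy, hpy⟩ := Set.mem_iUnion₂.mp (hcov hp)
      obtain ⟨w, hw, hpw⟩ := Set.mem_iUnion₂.mp (hfc y hpy)
      refine Set.mem_iUnion₂.mpr ⟨w, Finset.mem_biUnion.mpr ⟨y, hy, hw⟩, ?_⟩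
      rwa [pow_succ, ← div_div]

/-- Packing bound: in a ball of radius `r` there are at most `(4 r / s) ^ d` points with pairwise
distances more than `s`. -/
theorem HasDoublingDim.card_le_of_separated [Nonempty X] (h : HasDoublingDim X d) {x : X} {r s : ℝ}
    (hs : 0 < s) (hsr : s ≤ r) {ι : Type*} {B : Finset ι} {f : ι → X}
    (hB : ∀ b ∈ B, dist (f b) x ≤ r)
    (hsep : ∀ b ∈ B, ∀ b' ∈ B, b ≠ b' → s < dist (f b) (f b')) :
    (B.card : ℝ) ≤ (4 * r / s) ^ d := by
  classical
  have hr : 0 < r := hs.trans_le hsr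
  -- With `2 * r / s ≤ 2 ^ m`, a ball of radius `r / 2 ^ m` holds at most one of the separated
  -- points; rounding up costs a factor of at most two, whence `4 * r / s`.
  set m := ⌈Real.logb 2 (2 * r / s)⌉₊ with hm
  have hpos : 0 < 2 * r / s := by positivity
  have h1 : 2 * r / s ≤ 2 ^ m := by
    rw [← Real.rpow_natCast, ← Real.logb_le_iff_le_rpow one_lt_two hpos]
    exact Nat.le_ceil _
  have h2 : (2 : ℝ) ^ m ≤ 4 * r / s := by
    have hlog : 0 ≤ Real.logb 2 (2 * r / s) := by
      refine Real.logb_nonneg one_lt_two ?_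
      rw [le_div_iff₀ hs]; linarith
    have : (m : ℝ) ≤ Real.logb 2 (4 * r / s) := by
      have e : 4 * r / s = 2 * (2 * r / s) := by ring
      rw [e, Real.logb_mul two_ne_zero hpos.ne', Real.logb_self_eq_one one_lt_two]
      linarith [Nat.ceil_lt_add_one hlog]
    rwa [← Real.rpow_natCast, ← Real.le_logb_iff_rpow_le one_lt_two (by positivity)]
  obtain ⟨S, hS, hcov⟩ := h.exists_cover m x hr
  have hex : ∀ b, ∃ y, b ∈ B → y ∈ S ∧ dist (f b) y ≤ r / 2 ^ m := by
    intro b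
    by_cases hb : b ∈ B
    · obtain ⟨y, hy, hby⟩ := Set.mem_iUnion₂.mp (hcov (Metric.mem_closedBall.mpr (hB b hb)))
      exact ⟨y, fun _ => ⟨hy, hby⟩⟩
    · exact ⟨x, fun hb' => absurd hb' hb⟩
  choose g hg using hex
  have hcard : B.card ≤ S.card := by
    refine Finset.card_le_card_of_injOn g (fun b hb => (hg b hb).1) fun b hb b' hb' e => ?_
    by_contra hne
    have t1 := (hg b hb).2
    have t2 := (hg b' hb').2
    rw [← e] at t2
    have t3 : 2 * (r / 2 ^ m) ≤ s := by
      rw [← mul_div_assoc, div_le_iff₀ (by positivity), mul_comm s]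
      rwa [div_le_iff₀ hs] at h1
    linarith [hsep b hb b' hb' hne, dist_triangle_right (f b) (f b') (g b)]
  calc (B.card : ℝ) ≤ S.card := by exact_mod_cast hcard
    _ ≤ ((2 : ℝ) ^ d) ^ m := hS
    _ = ((2 : ℝ) ^ m) ^ d := by
      rw [← Real.rpow_natCast, ← Real.rpow_natCast, ← Real.rpow_mul zero_le_two,
        ← Real.rpow_mul zero_le_two, mul_comm]
    _ ≤ _ := Real.rpow_le_rpow (by positivity) h2 h.nonneg

end Doubling

/-! ### The newest items of a set -/

section Newest

theorem newestFirst_pairwise (Q : Finset ℕ) : (newestFirst Q).Pairwise (· > ·) :=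
  (Finset.sortedGT_sort Q).pairwise

theorem mem_newestFirst {Q : Finset ℕ} {x : ℕ} : x ∈ newestFirst Q ↔ x ∈ Q :=
  Finset.mem_sort _

theorem length_newestFirst (Q : Finset ℕ) : (newestFirst Q).length = Q.card :=
  Finset.length_sort _

theorem newest_subset (Q : Finset ℕ) (i : ℕ) : newest Q i ⊆ Q := fun _ hx =>
  mem_newestFirst.mp (List.mem_of_mem_take (List.mem_toFinset.mp hx))

theorem card_newest (Q : Finset ℕ) (i : ℕ) : (newest Q i).card = min i Q.card := by
  rw [newest, List.toFinset_card_of_nodup, List.length_take, length_newestFirst]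
  exact (Finset.sort_nodup _ _).sublist (List.take_sublist _ _)

theorem lt_of_notMem_newest {Q : Finset ℕ} {i x y : ℕ} (hx : x ∈ Q) (hxn : x ∉ newest Q i)
    (hy : y ∈ newest Q i) : x < y := by
  have hp := newestFirst_pairwise Q
  rw [← List.take_append_drop i (newestFirst Q), List.pairwise_append] at hp
  refine hp.2.2 y (List.mem_toFinset.mp hy) x ?_
  have := mem_newestFirst.mpr hx
  rw [← List.take_append_drop i (newestFirst Q), List.mem_append] at this
  exact this.resolve_left fun h => hxn (List.mem_toFinset.mpr h)

theorem newest_eq_self_of_getElem?_eq_none {Q : Finset ℕ} {i : ℕ}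
    (h : (newestFirst Q)[i]? = none) : newest Q i = Q := by
  refine Finset.eq_of_subset_of_card_le (newest_subset Q i) ?_
  rw [List.getElem?_eq_none_iff, length_newestFirst] at h
  rw [card_newest, min_eq_right h]

/-- List positions start at zero, so entry `i` is the first item beyond the `i` newest, called
$q_{i^*+1}$ in the algorithm. -/
theorem newest_succ_of_getElem?_eq_some {Q : Finset ℕ} {i q : ℕ}
    (h : (newestFirst Q)[i]? = some q) : newest Q (i + 1) = insert q (newest Q i) := by
  ext x
  simp only [newest, List.take_add_one, h, List.mem_toFinset, List.mem_append, Finset.mem_insert,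
    Option.toList_some, List.mem_singleton, or_comm]

theorem notMem_newest_of_getElem?_eq_some {Q : Finset ℕ} {i q : ℕ}
    (h : (newestFirst Q)[i]? = some q) : q ∉ newest Q i := by
  intro hq
  obtain ⟨hi, -⟩ := List.getElem?_eq_some_iff.mp h
  rw [length_newestFirst] at hi
  have h1 := congrArg Finset.card (newest_succ_of_getElem?_eq_some h)
  rw [Finset.insert_eq_of_mem hq, card_newest, card_newest] at h1
  omega

theorem le_of_notMem_newest {Q : Finset ℕ} {i q x : ℕ} (h : (newestFirst Q)[i]? = some q)
    (hx : x ∈ Q) (hxn : x ∉ newest Q i) : x ≤ q := by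
  by_cases hxq : x = q
  · exact hxq.le
  · have h1 := newest_succ_of_getElem?_eq_some h
    refine (lt_of_notMem_newest (i := i + 1) hx ?_ ?_).le
    · rw [h1, Finset.mem_insert]; tauto
    · rw [h1]; exact Finset.mem_insert_self _ _

theorem le_of_mem_newest_succ {Q : Finset ℕ} {i q x : ℕ} (h : (newestFirst Q)[i]? = some q)
    (hx : x ∈ newest Q (i + 1)) : q ≤ x := by
  rw [newest_succ_of_getElem?_eq_some h, Finset.mem_insert] at hx
  rcases hx with rfl | hx
  · exact le_rfl
  · exact (lt_of_notMem_newest (mem_newestFirst.mp (List.mem_of_getElem? h))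
      (notMem_newest_of_getElem?_eq_some h) hx).le

/-- If `x ≤ p` were among the `n` newest, then so would be all of `S`, at least `n` items different
from `x`: too many. This keeps the representatives newer than `p` when a set is truncated. -/
theorem lt_of_mem_newest {Q S : Finset ℕ} {n p x : ℕ} (hS : S ⊆ Q) (hn : n ≤ S.card)
    (hp : ∀ q ∈ S, p < q) (hx : x ∈ newest Q n) : p < x := by
  by_contra! hxp
  have hsub : S ⊆ (newest Q n).erase x := by
    intro y hy
    have hyp := hp y hy
    refine Finset.mem_erase.mpr ⟨by omega, ?_⟩
    by_contra hyn
    have := lt_of_notMem_newest (hS hy) hyn hx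
    omega
  have h1 := Finset.card_le_card hsub
  rw [Finset.card_erase_of_mem hx, card_newest] at h1
  have : 0 < (newest Q n).card := Finset.card_pos.mpr ⟨x, hx⟩
  rw [card_newest] at this
  omega

end Newest

/-! ### Distributing leftover items over mini-balls -/

section Distribute

variable {X : Type*} [MetricSpace X] {W s : ℝ} {P : PointStream X W} {l : List ℕ}
  {balls balls' : Finset ℕ} {rep rep' : ℕ → Finset ℕ}

theorem exists_distribute (P : PointStream X W) (s : ℝ) (l : List ℕ) (balls : Finset ℕ)
    (rep : ℕ → Finset ℕ) : ∃ balls' rep', Distribute P s l balls rep balls' rep' := by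
  induction l generalizing balls rep with
  | nil => exact ⟨_, _, .nil _ _⟩
  | cons q l ih =>
    by_cases h : ∃ b ∈ balls, dist (P.pt q) (P.pt b) ≤ s
    · obtain ⟨b, hb, hd⟩ := h
      obtain ⟨_, _, h'⟩ := ih balls (Function.update rep b (insert q (rep b)))
      exact ⟨_, _, .join _ _ _ _ _ _ b hb hd h'⟩
    · push Not at h
      obtain ⟨_, _, h'⟩ := ih (insert q balls) (Function.update rep q {q})
      exact ⟨_, _, .create _ _ _ _ _ _ h h'⟩

theorem Distribute.balls_subset (h : Distribute P s l balls rep balls' rep') : balls ⊆ balls' := by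
  induction h with
  | nil => exact subset_rfl
  | join _ _ _ _ _ _ _ _ _ _ ih => exact ih
  | create _ _ _ _ _ _ _ _ ih => exact (Finset.subset_insert _ _).trans ih

theorem Distribute.subset_union (h : Distribute P s l balls rep balls' rep') :
    balls' ⊆ balls ∪ l.toFinset := by
  induction h with
  | nil => simp
  | join _ _ _ _ _ _ _ _ _ _ ih =>
    refine ih.trans (Finset.union_subset_union le_rfl ?_)
    intro x hx; simp only [List.toFinset_cons, Finset.mem_insert]; exact Or.inr hx
  | create _ _ _ _ _ _ _ _ ih =>
    intro x hx
    have := ih hx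
    simp only [Finset.mem_union, Finset.mem_insert, List.toFinset_cons] at this ⊢
    tauto

theorem Distribute.separated (h : Distribute P s l balls rep balls' rep')
    (hsep : ∀ b ∈ balls, ∀ b' ∈ balls, b ≠ b' → s < dist (P.pt b) (P.pt b')) :
    ∀ b ∈ balls', ∀ b' ∈ balls', b ≠ b' → s < dist (P.pt b) (P.pt b') := by
  induction h with
  | nil => exact hsep
  | join _ _ _ _ _ _ _ _ _ _ ih => exact ih hsep
  | create q l balls balls' rep rep' hq _ ih =>
    refine ih fun b hb b' hb' hne => ?_
    rw [Finset.mem_insert] at hb hb'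
    rcases hb with rfl | hb <;> rcases hb' with rfl | hb'
    · exact absurd rfl hne
    · exact hq b' hb'
    · rw [dist_comm]; exact hq b hb
    · exact hsep b hb b' hb' hne

theorem Distribute.dist_le (h : Distribute P s l balls rep balls' rep') (hs : 0 ≤ s)
    (hd : ∀ b ∈ balls, ∀ q ∈ rep b, dist (P.pt q) (P.pt b) ≤ s) :
    ∀ b ∈ balls', ∀ q ∈ rep' b, dist (P.pt q) (P.pt b) ≤ s := by
  induction h with
  | nil => exact hd
  | join q l balls balls' rep rep' b hb hqb _ ih =>
    refine ih fun b' hb' x hx => ?_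
    by_cases hbb : b' = b
    · subst hbb
      rw [Function.update_self, Finset.mem_insert] at hx
      rcases hx with rfl | hx
      · exact hqb
      · exact hd _ hb _ hx
    · rw [Function.update_of_ne hbb] at hx
      exact hd _ hb' _ hx
  | create q l balls balls' rep rep' hq _ ih =>
    refine ih fun b' hb' x hx => ?_
    by_cases hbb : b' = q
    · subst hbb
      rw [Function.update_self, Finset.mem_singleton] at hx
      rw [hx, dist_self]; exact hs
    · rw [Function.update_of_ne hbb] at hx
      exact hd _ (Finset.mem_of_mem_insert_of_ne hb' hbb) _ hx

/-- Creating a ball at `q` resets the set indexed by `q`. Nothing is lost, because an existing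
center is at distance `0 ≤ s` from itself and would have been joined. -/
theorem Distribute.rep_subset (h : Distribute P s l balls rep balls' rep') (hs : 0 ≤ s) :
    ∀ b ∈ balls, rep b ⊆ rep' b := by
  induction h with
  | nil => exact fun _ _ => subset_rfl
  | join q l balls balls' rep rep' b _ _ _ ih =>
    intro b' hb'
    refine subset_trans ?_ (ih b' hb')
    by_cases hbb : b' = b
    · subst hbb
      rw [Function.update_self]; exact Finset.subset_insert _ _
    · rw [Function.update_of_ne hbb]
  | create q l balls balls' rep rep' hq _ ih =>
    intro b' hb'
    refine subset_trans ?_ (ih b' (Finset.mem_insert_of_mem hb'))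
    have hbb : b' ≠ q := by
      rintro rfl
      have := hq b' hb'
      rw [dist_self] at this
      exact absurd this (not_lt.mpr hs)
    rw [Function.update_of_ne hbb]

theorem biUnion_update_insert {b : ℕ} (hb : b ∈ balls) (q : ℕ) :
    balls.biUnion (Function.update rep b (insert q (rep b))) = insert q (balls.biUnion rep) := by
  ext x
  simp only [Finset.mem_biUnion, Finset.mem_insert]
  constructor
  · rintro ⟨a, ha, hx⟩
    by_cases hab : a = b
    · subst hab
      rw [Function.update_self, Finset.mem_insert] at hx
      exact hx.imp_right fun h => ⟨a, ha, h⟩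
    · rw [Function.update_of_ne hab] at hx
      exact Or.inr ⟨a, ha, hx⟩
  · rintro (rfl | ⟨a, ha, hx⟩)
    · exact ⟨b, hb, by rw [Function.update_self]; exact Finset.mem_insert_self _ _⟩
    · refine ⟨a, ha, ?_⟩
      by_cases hab : a = b
      · subst hab
        rw [Function.update_self]; exact Finset.mem_insert_of_mem hx
      · rwa [Function.update_of_ne hab]

theorem biUnion_insert_update {q : ℕ} (hq : q ∉ balls) :
    (insert q balls).biUnion (Function.update rep q {q}) = insert q (balls.biUnion rep) := by
  rw [Finset.biUnion_insert, Function.update_self, ← Finset.insert_eq]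
  congr 1
  refine Finset.biUnion_congr rfl fun b hb => Function.update_of_ne ?_ _ _
  rintro rfl
  exact hq hb

theorem Distribute.biUnion_eq (h : Distribute P s l balls rep balls' rep') (hs : 0 ≤ s) :
    balls'.biUnion rep' = balls.biUnion rep ∪ l.toFinset := by
  induction h with
  | nil => simp
  | join q l balls balls' rep rep' b hb _ _ ih =>
    rw [ih, biUnion_update_insert hb, List.toFinset_cons, Finset.insert_union, Finset.union_insert]
  | create q l balls balls' rep rep' hq _ ih =>
    have : q ∉ balls := fun hb => by
      have := hq q hb
      rw [dist_self] at this
      exact absurd this (not_lt.mpr hs)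
    rw [ih, biUnion_insert_update this, List.toFinset_cons, Finset.insert_union,
      Finset.union_insert]

end Distribute

/-! ### How the window changes at events -/

section Window

variable {X : Type*} {W : ℝ} {P : PointStream X W}

theorem mem_windowItems {t : ℝ} {i : ℕ} :
    i ∈ P.windowItems t ↔ (i : ℕ∞) < P.len ∧ P.arr i ≤ t ∧ t < P.expire i := by
  simp [PointStream.windowItems, and_assoc]

theorem windowItems_lt_len {t : ℝ} : ∀ i ∈ P.windowItems t, (i : ℕ∞) < P.len := fun _ hi =>
  (mem_windowItems.mp hi).1

theorem expire_le_expire {i j : ℕ} (hij : i ≤ j) (hj : (j : ℕ∞) < P.len) :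
    P.expire i ≤ P.expire j := by
  rcases hij.eq_or_lt with rfl | h
  · exact le_rfl
  · exact add_le_add_left (P.arr_lt i j h hj).le W

theorem arr_injOn {i j : ℕ} (hi : (i : ℕ∞) < P.len) (hj : (j : ℕ∞) < P.len)
    (h : P.arr i = P.arr j) : i = j := by
  rcases lt_trichotomy i j with hij | hij | hij
  · exact absurd h (P.arr_lt i j hij hj).ne
  · exact hij
  · exact absurd h (P.arr_lt j i hij hi).ne'

theorem arr_mem_eventTimes {i : ℕ} (hi : (i : ℕ∞) < P.len) : P.arr i ∈ P.eventTimes :=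
  ⟨i, hi, Or.inl rfl⟩

theorem expire_mem_eventTimes {i : ℕ} (hi : (i : ℕ∞) < P.len) : P.expire i ∈ P.eventTimes :=
  ⟨i, hi, Or.inr rfl⟩

theorem windowItems_eq_of_forall_notMem {s t : ℝ} (hst : s ≤ t)
    (h : ∀ u ∈ P.eventTimes, u ∉ Set.Ioc s t) : P.windowItems t = P.windowItems s := by
  ext i
  rw [mem_windowItems, mem_windowItems]
  refine and_congr_right fun hi => and_congr ⟨fun ha => ?_, fun ha => ha.trans hst⟩
    ⟨fun he => hst.trans_lt he, fun he => ?_⟩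
  · by_contra! hlt
    exact h _ (arr_mem_eventTimes hi) ⟨hlt, ha⟩
  · by_contra! hle
    exact h _ (expire_mem_eventTimes hi) ⟨he, hle⟩

theorem windowItems_arr {s : ℝ} {j : ℕ} (hW : 0 < W) (hj : (j : ℕ∞) < P.len) (hs : s < P.arr j)
    (h : ∀ u ∈ P.eventTimes, u ∉ Set.Ioo s (P.arr j)) :
    P.windowItems (P.arr j) = insert j (P.windowItems s) := by
  ext i
  rw [Finset.mem_insert, mem_windowItems, mem_windowItems]
  constructor
  · rintro ⟨hi, ha, he⟩
    by_cases hij : i = j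
    · exact Or.inl hij
    · refine Or.inr ⟨hi, ?_, hs.trans he⟩
      by_contra! hlt
      exact h _ (arr_mem_eventTimes hi) ⟨hlt, ha.lt_of_ne fun e => hij (arr_injOn hi hj e)⟩
  · rintro (rfl | ⟨hi, ha, he⟩)
    · exact ⟨hj, le_rfl, lt_add_of_pos_right _ hW⟩
    · refine ⟨hi, ha.trans hs.le, ?_⟩
      by_contra! hle
      exact h _ (expire_mem_eventTimes hi) ⟨he, hle.lt_of_ne (P.arr_ne j i hj hi).symm⟩

theorem windowItems_expire {s : ℝ} {j : ℕ} (hj : (j : ℕ∞) < P.len)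
    (hs : s < P.expire j) (h : ∀ u ∈ P.eventTimes, u ∉ Set.Ioo s (P.expire j)) :
    P.windowItems (P.expire j) = (P.windowItems s).erase j := by
  ext i
  rw [Finset.mem_erase, mem_windowItems, mem_windowItems]
  constructor
  · rintro ⟨hi, ha, he⟩
    refine ⟨fun hij => he.ne (by rw [hij]), hi, ?_, hs.trans he⟩
    by_contra! hlt
    exact h _ (arr_mem_eventTimes hi) ⟨hlt, ha.lt_of_ne (P.arr_ne i j hi hj)⟩
  · rintro ⟨hij, hi, ha, he⟩
    refine ⟨hi, ha.trans hs.le, ?_⟩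
    by_contra! hle
    refine h _ (expire_mem_eventTimes hi) ⟨he, hle.lt_of_ne fun e => hij (arr_injOn hi hj ?_)⟩
    exact add_right_cancel (b := W) e

theorem finite_eventTimes_inter_Iic (hW : 0 ≤ W) (t : ℝ) : (P.eventTimes ∩ Set.Iic t).Finite := by
  refine (((P.finite_arr t).image P.arr).union ((P.finite_arr t).image P.expire)).subset ?_
  rintro u ⟨⟨i, hi, rfl | rfl⟩, hu⟩
  · exact Or.inl ⟨i, ⟨hi, hu⟩, rfl⟩
  · exact Or.inr ⟨i, ⟨hi, le_trans (le_add_of_nonneg_right hW) hu⟩, rfl⟩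

end Window

theorem mem_items {Γ : Sketch} {x : ℕ} : x ∈ Γ.items ↔ x ∈ Γ.out ∨ ∃ b ∈ Γ.balls, x ∈ Γ.rep b := by
  simp [Sketch.items]

/-! ### The invariant and its preservation -/

section Invariant

variable {X : Type*} [MetricSpace X] {W : ℝ}

/-- The sketch `Γ` with mini-balls of radius `s` represents the set `V` of items: the mini-balls are
separated and contain their representatives, and every item of `V` is stored, or expires before the
timestamp, or lies in a mini-ball with more than `z` representatives, all of them newer. -/
structure Represents (P : PointStream X W) (z : ℕ) (s : ℝ) (V : Finset ℕ) (Γ : Sketch) : Prop where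
  items_subset : Γ.items ⊆ V
  dist_le : ∀ b ∈ Γ.balls, ∀ q ∈ Γ.rep b, dist (P.pt q) (P.pt b) ≤ s
  separated : ∀ b ∈ Γ.balls, ∀ b' ∈ Γ.balls, b ≠ b' → s < dist (P.pt b) (P.pt b')
  covered : ∀ p ∈ V, p ∈ Γ.items ∨ P.expire p ≤ Γ.τ ∨
    ∃ b ∈ Γ.balls, dist (P.pt p) (P.pt b) ≤ s ∧ z + 1 ≤ (Γ.rep b).card ∧ ∀ q ∈ Γ.rep b, p < q

/-- The size bounds of a sketch between updates; the centers of its mini-balls are within distance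
`R` of `k` points. -/
structure SizeBounds (P : PointStream X W) (k z : ℕ) (R : ℝ) (Γ : Sketch) : Prop where
  card_rep : ∀ b ∈ Γ.balls, (Γ.rep b).card ≤ z + 1
  card_out : Γ.out.card ≤ z
  centers : ∃ center : Fin k → X, ∀ b ∈ Γ.balls, ∃ l, dist (P.pt b) (center l) ≤ R

/-- A positive timestamp `τ` is justified by a set of items that arrived up to time `t`, do not
expire before `τ`, and cannot be covered by `k` balls of radius `2 * ρ`. -/
def TimestampJustified (P : PointStream X W) (k z : ℕ) (ρ t τ : ℝ) : Prop :=
  τ ≤ 0 ∨ ∃ T : Finset ℕ, (∀ q ∈ T, (q : ℕ∞) < P.len ∧ P.arr q ≤ t ∧ τ ≤ P.expire q) ∧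
    2 * ρ < opt k z (P.points T)

variable {P : PointStream X W} {k z : ℕ} {A : Solver X k} {c ρ ε s t : ℝ} {V : Finset ℕ}
  {Γ Γ' : Sketch} {j : ℕ}

theorem TimestampJustified.mono {τ t' : ℝ} (h : TimestampJustified P k z ρ t τ) (htt : t ≤ t') :
    TimestampJustified P k z ρ t' τ :=
  h.imp_right fun ⟨T, hT, ho⟩ => ⟨T, fun q hq => ⟨(hT q hq).1, (hT q hq).2.1.trans htt,
    (hT q hq).2.2⟩, ho⟩

/-- The witnesses have arrived and expire no earlier than `τ`, so while `t < τ` they all lie in the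
window. -/
theorem TimestampJustified.lt_opt_window [Nonempty X] (hk : 1 ≤ k) {τ : ℝ} (ht : 0 ≤ t)
    (h : TimestampJustified P k z ρ t τ) (hτ : t < τ) : 2 * ρ < opt k z (P.window t) := by
  obtain ⟨T, hT, ho⟩ := h.resolve_left fun h0 => by linarith
  refine ho.trans_le (opt_points_mono hk fun q hq => ?_)
  obtain ⟨h1, h2, h3⟩ := hT q hq
  exact mem_windowItems.mpr ⟨h1, h2, hτ.trans_le h3⟩

theorem represents_empty : Represents P z s ∅ Sketch.empty where
  items_subset := by simp [Sketch.empty, Sketch.items]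
  dist_le := by simp [Sketch.empty]
  separated := by simp [Sketch.empty]
  covered := by simp

theorem sizeBounds_empty [Nonempty X] {R : ℝ} : SizeBounds P k z R Sketch.empty where
  card_rep := by simp [Sketch.empty]
  card_out := by simp [Sketch.empty]
  centers := ⟨fun _ => Classical.arbitrary X, by simp [Sketch.empty]⟩

/-- The departing item is the oldest, so it is never among the newer representatives that vouch for
another item. -/
theorem Represents.depart (h : Represents P z s V Γ) (hV : ∀ p ∈ V, p ≠ j → j < p) :
    Represents P z s (V.erase j) (Γ.depart j) where
  items_subset := by
    intro x hx
    rcases mem_items.mp hx with hx | ⟨b, hb, hx⟩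
    · obtain ⟨hxj, hx⟩ := Finset.mem_erase.mp hx
      exact Finset.mem_erase.mpr ⟨hxj, h.items_subset (mem_items.mpr (Or.inl hx))⟩
    · obtain ⟨hxj, hx⟩ := Finset.mem_erase.mp hx
      exact Finset.mem_erase.mpr
        ⟨hxj, h.items_subset (mem_items.mpr (Or.inr ⟨b, (Finset.mem_filter.mp hb).1, hx⟩))⟩
  dist_le := fun b hb q hq =>
    h.dist_le b (Finset.mem_filter.mp hb).1 q (Finset.mem_of_mem_erase hq)
  separated := fun b hb b' hb' =>
    h.separated b (Finset.mem_filter.mp hb).1 b' (Finset.mem_filter.mp hb').1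
  covered := by
    intro p hp
    obtain ⟨hpj, hp⟩ := Finset.mem_erase.mp hp
    rcases h.covered p hp with hi | hτ | ⟨b, hb, hd, hc, hn⟩
    · left
      rcases mem_items.mp hi with hx | ⟨b, hb, hx⟩
      · exact mem_items.mpr (Or.inl (Finset.mem_erase.mpr ⟨hpj, hx⟩))
      · refine mem_items.mpr (Or.inr ⟨b, Finset.mem_filter.mpr ⟨hb, fun e => hpj ?_⟩,
          Finset.mem_erase.mpr ⟨hpj, hx⟩⟩)
        rwa [e, Finset.mem_singleton] at hx
    · exact Or.inr (Or.inl hτ)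
    · have hjb : j ∉ Γ.rep b := fun hj => (hn j hj).asymm (hV p hp hpj)
      have he : (Γ.depart j).rep b = Γ.rep b := Finset.erase_eq_of_notMem hjb
      refine Or.inr (Or.inr ⟨b, Finset.mem_filter.mpr ⟨hb, fun e => hjb ?_⟩, hd, ?_, ?_⟩)
      · rw [e]; exact Finset.mem_singleton_self j
      · rwa [he]
      · rwa [he]

theorem SizeBounds.depart {R : ℝ} (h : SizeBounds P k z R Γ) (j : ℕ) :
    SizeBounds P k z R (Γ.depart j) where
  card_rep := fun b hb => (Finset.card_le_card (Finset.erase_subset _ _)).trans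
    (h.card_rep b (Finset.mem_filter.mp hb).1)
  card_out := (Finset.card_le_card (Finset.erase_subset _ _)).trans h.card_out
  centers := h.centers.imp fun _ hc b hb => hc b (Finset.mem_filter.mp hb).1

theorem InsertItem.items_eq (h : InsertItem P s Γ j Γ') : Γ'.items = insert j Γ.items := by
  rcases h with ⟨b, hb, -, rfl⟩ | ⟨-, rfl⟩
  · simp only [Sketch.items]
    rw [biUnion_update_insert hb, Finset.union_insert]
  · simp only [Sketch.items, Finset.insert_union]

theorem InsertItem.timestamp_eq (h : InsertItem P s Γ j Γ') : Γ'.τ = Γ.τ := by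
  rcases h with ⟨b, hb, -, rfl⟩ | ⟨-, rfl⟩ <;> rfl

theorem Represents.insertItem (h : Represents P z s V Γ) (hV : ∀ p ∈ V, p < j)
    (hi : InsertItem P s Γ j Γ') : Represents P z s (insert j V) Γ' where
  items_subset := by
    rw [hi.items_eq]
    exact Finset.insert_subset_insert _ h.items_subset
  dist_le := by
    rcases hi with ⟨b, hb, hd, rfl⟩ | ⟨-, rfl⟩
    · intro b' hb' q hq
      by_cases hbb : b' = b
      · subst hbb
        simp only [Function.update_self, Finset.mem_insert] at hq
        rcases hq with rfl | hq
        · exact hd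
        · exact h.dist_le _ hb q hq
      · simp only [Function.update_of_ne hbb] at hq
        exact h.dist_le _ hb' q hq
    · exact h.dist_le
  separated := by
    rcases hi with ⟨b, hb, hd, rfl⟩ | ⟨-, rfl⟩
    · exact h.separated
    · exact h.separated
  covered := by
    intro p hp
    rw [hi.items_eq, hi.timestamp_eq]
    rcases Finset.mem_insert.mp hp with rfl | hpV
    · exact Or.inl (Finset.mem_insert_self _ _)
    rcases h.covered p hpV with hx | hτ | ⟨b, hb, hd, hc, hn⟩
    · exact Or.inl (Finset.mem_insert_of_mem hx)
    · exact Or.inr (Or.inl hτ)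
    · refine Or.inr (Or.inr ⟨b, ?_⟩)
      rcases hi with ⟨b', hb', hd', rfl⟩ | ⟨-, rfl⟩
      · refine ⟨hb, hd, ?_⟩
        by_cases hbb : b = b'
        · subst hbb
          simp only [Function.update_self]
          refine ⟨hc.trans (Finset.card_le_card (Finset.subset_insert _ _)), fun q hq => ?_⟩
          rcases Finset.mem_insert.mp hq with rfl | hq
          · exact hV p hpV
          · exact hn q hq
        · simp only [Function.update_of_ne hbb]
          exact ⟨hc, hn⟩
      · exact ⟨hb, hd, hc, hn⟩

theorem mem_keptBalls {sol : (Fin k → X) × ℝ} {b : ℕ} :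
    b ∈ keptBalls P s Γ sol ↔ b ∈ Γ.balls ∧ ∃ l, dist (P.pt b) (sol.1 l) ≤ sol.2 + s :=
  Finset.mem_filter

theorem keptRep_of_mem {sol : (Fin k → X) × ℝ} {Qi : Finset ℕ} {b : ℕ}
    (hb : b ∈ keptBalls P s Γ sol) : keptRep P s Γ sol Qi b = Γ.rep b ∩ Qi := if_pos hb

theorem mem_leftoverIn {sol : (Fin k → X) × ℝ} {Qi : Finset ℕ} {q : ℕ} :
    q ∈ leftoverIn P s Γ sol Qi ↔
      q ∈ leftover P s Γ sol Qi ∧ ∃ l, dist (P.pt q) (sol.1 l) ≤ sol.2 + s :=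
  Finset.mem_filter

theorem leftover_subset {sol : (Fin k → X) × ℝ} {Qi : Finset ℕ} :
    leftover P s Γ sol Qi ⊆ Qi := Finset.sdiff_subset

theorem leftoverIn_subset {sol : (Fin k → X) × ℝ} {Qi : Finset ℕ} :
    leftoverIn P s Γ sol Qi ⊆ leftover P s Γ sol Qi := Finset.filter_subset _ _

theorem biUnion_keptRep_union_leftover {sol : (Fin k → X) × ℝ} {Qi : Finset ℕ} :
    (keptBalls P s Γ sol).biUnion (keptRep P s Γ sol Qi) ∪ leftover P s Γ sol Qi = Qi := by
  refine Finset.union_sdiff_of_subset ?_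
  intro x hx
  obtain ⟨b, hb, hx⟩ := Finset.mem_biUnion.mp hx
  rw [keptRep_of_mem hb] at hx
  exact (Finset.mem_inter.mp hx).2

theorem HandleArrival.items_subset (hs : 0 ≤ ε * ρ) (h : HandleArrival P z A c ρ ε Γ j Γ') :
    Γ'.items ⊆ insert j Γ.items := by
  obtain ⟨Γ₁, i, l, rep₂, hins, -, -, -, hl, hdist, hrep, hout⟩ := h
  rw [← hins.items_eq]
  intro x hx
  refine newest_subset _ i ?_
  rcases mem_items.mp hx with hx | ⟨b, hb, hx⟩
  · rw [hout] at hx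
    exact leftover_subset (Finset.mem_sdiff.mp hx).1
  · rw [hrep] at hx
    have hx₂ : x ∈ Γ'.balls.biUnion rep₂ := Finset.mem_biUnion.mpr ⟨b, hb, newest_subset _ _ hx⟩
    rw [hdist.biUnion_eq hs, hl] at hx₂
    rw [← biUnion_keptRep_union_leftover (P := P) (s := ε * ρ) (Γ := Γ₁)
      (sol := A (P.points (newest Γ₁.items i))) (Qi := newest Γ₁.items i)]
    exact Finset.union_subset_union le_rfl leftoverIn_subset hx₂

theorem HandleArrival.timestampJustified [Nonempty X] (hA : A.IsApprox z c) (hc : 1 ≤ c)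
    (hΓ : ∀ q ∈ insert j Γ.items, (q : ℕ∞) < P.len ∧ P.arr q ≤ t)
    (hτ : TimestampJustified P k z ρ t Γ.τ) (h : HandleArrival P z A c ρ ε Γ j Γ') :
    TimestampJustified P k z ρ t Γ'.τ := by
  obtain ⟨Γ₁, i, l, rep₂, hins, hgr, hτ', -⟩ := h
  rw [← hins.items_eq] at hΓ
  cases hq : (newestFirst Γ₁.items)[i]? with
  | none => rw [hq] at hτ'; rwa [hτ']
  | some q =>
    replace hτ' : Γ'.τ = max Γ.τ (P.expire q) := by rw [hτ', hq]
    rcases le_total (P.expire q) Γ.τ with hle | hle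
    · rwa [hτ', max_eq_left hle]
    · rw [hτ', max_eq_right hle]
      -- The oldest of these `i + 1` items is `q`, whose expiration is the new timestamp; by
      -- maximality of `i`, the solver exceeds `2 * c * ρ` on them.
      refine Or.inr ⟨newest Γ₁.items (i + 1), fun x hx => ?_, ?_⟩
      · obtain ⟨h1, h2⟩ := hΓ x (newest_subset _ _ hx)
        exact ⟨h1, h2, expire_le_expire (le_of_mem_newest_succ hq hx) h1⟩
      · obtain ⟨hi, -⟩ := List.getElem?_eq_some_iff.mp hq
        rw [length_newestFirst] at hi
        have hlt : 2 * c * ρ < (A (P.points (newest Γ₁.items (i + 1)))).2 := by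
          by_contra! hle'
          exact absurd (hgr.2 ⟨hi, hle'⟩) (by omega)
        have := hlt.trans_le (hA (P.points (newest Γ₁.items (i + 1)))).2
        have hc0 : 0 < c := by linarith
        refine lt_of_mul_lt_mul_left (a := c) ?_ hc0.le
        linarith

theorem HandleArrival.represents (hA : A.IsApprox z c) (hs : 0 ≤ ε * ρ)
    (hlen : ∀ p ∈ insert j V, (p : ℕ∞) < P.len)
    (hV : ∀ p ∈ V, p < j) (hΓ : Represents P z (ε * ρ) V Γ)
    (h : HandleArrival P z A c ρ ε Γ j Γ') :
    Represents P z (ε * ρ) (insert j V) Γ' ∧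
      SizeBounds P k z (2 * c * ρ + ε * ρ) Γ' := by
  have hsub := h.items_subset hs
  obtain ⟨Γ₁, i, l, rep₂, hins, hgr, hτ', hln, hl, hdist, hrep, hout⟩ := h
  have h₁ := hΓ.insertItem hV hins
  set Q := Γ₁.items with hQ
  set Qi := newest Q i with hQi
  set sol := A (P.points Qi) with hsol
  have hr : sol.2 ≤ 2 * c * ρ := hgr.1.2
  have hsolQ := isSolution_points_iff.mp (hA (P.points Qi)).1
  have hball : ∀ b ∈ Γ'.balls, ∃ l, dist (P.pt b) (sol.1 l) ≤ sol.2 + ε * ρ := by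
    intro b hb
    have := hdist.subset_union hb
    rw [hl] at this
    rcases Finset.mem_union.mp this with hb | hb
    · exact (mem_keptBalls.mp hb).2
    · exact (mem_leftoverIn.mp hb).2
  have hclose := hdist.dist_le hs fun b hb q hq => by
    rw [keptRep_of_mem hb] at hq
    exact h₁.dist_le b (mem_keptBalls.mp hb).1 q (Finset.mem_inter.mp hq).1
  have hτle : Γ.τ ≤ Γ'.τ := by
    rw [hτ']
    cases (newestFirst Q)[i]? with
    | none => exact le_rfl
    | some q => exact le_max_left _ _
  -- items outside of `Qi` expire before the new timestamp
  have hold : ∀ q ∈ Q, q ∉ Qi → P.expire q ≤ Γ'.τ := by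
    intro q hq hqi
    cases hx : (newestFirst Q)[i]? with
    | none => rw [hQi, newest_eq_self_of_getElem?_eq_none hx] at hqi; exact absurd hq hqi
    | some x =>
      replace hτ' : Γ'.τ = max Γ.τ (P.expire x) := by rw [hτ', hx]
      rw [hτ']
      have hxQ : x ∈ Q := mem_newestFirst.mp (List.mem_of_getElem? hx)
      exact (expire_le_expire (le_of_notMem_newest hx hq hqi)
        (hlen x (h₁.items_subset hxQ))).trans (le_max_right _ _)
  refine ⟨⟨fun x hx => ?_, fun b hb q hq => ?_, ?_, fun p hp => ?_⟩, fun b hb => ?_, ?_, sol.1,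
    fun b hb => ?_⟩
  · exact h₁.items_subset (hins.items_eq ▸ hsub hx)
  · rw [hrep] at hq
    exact hclose b hb q (newest_subset _ _ hq)
  · exact hdist.separated fun b hb b' hb' =>
      h₁.separated b (mem_keptBalls.mp hb).1 b' (mem_keptBalls.mp hb').1
  · rcases h₁.covered p hp with hpQ | hτ | ⟨b, hb, hd, hcard, hn⟩
    · by_cases hpi : p ∈ Qi
      · rw [← biUnion_keptRep_union_leftover (P := P) (s := ε * ρ) (Γ := Γ₁) (sol := sol)
          (Qi := Qi)] at hpi
        by_cases hpo : p ∈ Γ'.out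
        · exact Or.inl (mem_items.mpr (Or.inl hpo))
        · have hp₂ : p ∈ Γ'.balls.biUnion rep₂ := by
            rw [hdist.biUnion_eq hs, hl]
            rw [hout, Finset.mem_sdiff, not_and_not_right] at hpo
            rcases Finset.mem_union.mp hpi with hpi | hpi
            · exact Finset.mem_union_left _ hpi
            · exact Finset.mem_union_right _ (hpo hpi)
          obtain ⟨b, hb, hpb⟩ := Finset.mem_biUnion.mp hp₂
          by_cases hpn : p ∈ newest (rep₂ b) (z + 1)
          · exact Or.inl (mem_items.mpr (Or.inr ⟨b, hb, by rwa [hrep]⟩))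
          -- An item lost by truncation leaves behind exactly `z + 1` newer representatives.
          · refine Or.inr (Or.inr ⟨b, hb, hclose b hb p hpb, ?_, fun q hq => ?_⟩)
            · rw [hrep, card_newest]
              refine le_min le_rfl ?_
              by_contra! hlt
              have : newest (rep₂ b) (z + 1) = rep₂ b :=
                Finset.eq_of_subset_of_card_le (newest_subset _ _)
                  (by rw [card_newest, min_eq_right hlt.le])
              exact hpn (by rwa [this])
            · rw [hrep] at hq
              exact lt_of_notMem_newest hpb hpn hq
      · exact Or.inr (Or.inl (hold p hpQ hpi))
    · rw [hins.timestamp_eq] at hτ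
      exact Or.inr (Or.inl (hτ.trans hτle))
    · by_cases hbQ : Γ₁.rep b ⊆ Qi
      · have hbk : b ∈ keptBalls P (ε * ρ) Γ₁ sol := by
          -- If the center lay outside the expanded balls, every representative would lie outside
          -- the unexpanded ones, giving more than `z` outliers.
          by_contra hbk
          have : Γ₁.rep b ⊆ uncovered P Qi sol.1 sol.2 := fun q hq =>
            mem_uncovered.mpr ⟨hbQ hq, fun ⟨l, hl⟩ => hbk (mem_keptBalls.mpr ⟨hb, l, by
              linarith [dist_triangle_left (P.pt b) (sol.1 l) (P.pt q), h₁.dist_le b hb q hq]⟩)⟩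
          have := (Finset.card_le_card this).trans hsolQ.2
          omega
        have hsub₂ : Γ₁.rep b ⊆ rep₂ b := by
          have := hdist.rep_subset hs b hbk
          rwa [keptRep_of_mem hbk, Finset.inter_eq_left.mpr hbQ] at this
        refine Or.inr (Or.inr ⟨b, hdist.balls_subset hbk, hd, ?_, fun q hq => ?_⟩)
        · rw [hrep, card_newest]
          exact le_min le_rfl (hcard.trans (Finset.card_le_card hsub₂))
        · rw [hrep] at hq
          exact lt_of_mem_newest hsub₂ hcard hn hq
      -- A newer representative was cut off, so the older `p` expires before the new timestamp too.
      · obtain ⟨q, hq, hqi⟩ := Finset.not_subset.mp hbQ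
        have hqQ : q ∈ Q := mem_items.mpr (Or.inr ⟨b, hb, hq⟩)
        exact Or.inr (Or.inl ((expire_le_expire (hn q hq).le
          (hlen q (h₁.items_subset hqQ))).trans (hold q hqQ hqi)))
  · rw [hrep, card_newest]
    exact min_le_left _ _
  · refine (Finset.card_le_card fun q hq => ?_).trans hsolQ.2
    rw [hout, Finset.mem_sdiff] at hq
    exact mem_uncovered.mpr ⟨leftover_subset hq.1, fun ⟨m, hm⟩ =>
      -- Items outside the expanded balls are in particular outliers of the reported solution.
      hq.2 (mem_leftoverIn.mpr ⟨hq.1, m, hm.trans (le_add_of_nonneg_right hs)⟩)⟩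
  · obtain ⟨m, hm⟩ := hball b hb
    exact ⟨m, hm.trans (add_le_add_left hr _)⟩

theorem SketchAt.invariant [Nonempty X] (hA : A.IsApprox z c) (hc : 1 ≤ c) (hs : 0 ≤ ε * ρ)
    (hW : 0 < W) (h : SketchAt P z A c ρ ε t Γ) :
    Represents P z (ε * ρ) (P.windowItems t) Γ ∧ SizeBounds P k z (2 * c * ρ + ε * ρ) Γ ∧
      TimestampJustified P k z ρ t Γ.τ := by
  induction h with
  | start =>
    have : P.windowItems 0 = ∅ := Finset.eq_empty_of_forall_notMem fun i hi => by
      obtain ⟨hi, ha, -⟩ := mem_windowItems.mp hi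
      exact absurd ha (not_le.mpr (P.arr_pos i hi))
    rw [this]
    exact ⟨represents_empty, sizeBounds_empty, Or.inl le_rfl⟩
  | wait s t Γ _ hst hev ih =>
    rw [windowItems_eq_of_forall_notMem hst hev]
    exact ⟨ih.1, ih.2.1, ih.2.2.mono hst⟩
  | arrive s Γ Γ' j _ hj hst hev hΓ' ih =>
    have hwin := windowItems_arr hW hj hst hev
    have hlen : ∀ p ∈ insert j (P.windowItems s), (p : ℕ∞) < P.len ∧ P.arr p ≤ P.arr j := by
      intro p hp
      rw [← hwin] at hp
      exact ⟨(mem_windowItems.mp hp).1, (mem_windowItems.mp hp).2.1⟩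
    have hlt : ∀ p ∈ P.windowItems s, p < j := by
      intro p hp
      obtain ⟨hp, ha, -⟩ := mem_windowItems.mp hp
      by_contra! hjp
      rcases hjp.eq_or_lt with rfl | hjp
      · exact absurd ha (not_le.mpr hst)
      · exact absurd (ha.trans_lt hst) (P.arr_lt j p hjp hp).asymm
    have := hΓ'.represents hA hs (fun p hp => (hlen p hp).1) hlt ih.1
    rw [hwin]
    refine ⟨this.1, this.2, hΓ'.timestampJustified hA hc (fun q hq => hlen q ?_)
      (ih.2.2.mono hst.le)⟩
    exact Finset.insert_subset_insert _ ih.1.items_subset hq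
  | depart s Γ j _ hj hst hev ih =>
    have hwin := windowItems_expire hj hst hev
    rw [hwin]
    refine ⟨ih.1.depart fun p hp hpj => ?_, ih.2.1.depart j, ih.2.2.mono hst.le⟩
    have hp' : p ∈ P.windowItems (P.expire j) := hwin ▸ Finset.mem_erase.mpr ⟨hpj, hp⟩
    by_contra! hle
    exact absurd (mem_windowItems.mp hp').2.2 (not_lt.mpr (expire_le_expire hle hj))

end Invariant

/-! ### Existence of runs -/

section Existence

variable {X : Type*} [MetricSpace X] {W : ℝ} {P : PointStream X W} {k z : ℕ} {A : Solver X k}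
  {c ρ ε t : ℝ}

theorem exists_handleArrival [Nonempty X] (hA : A.IsApprox z c) (hk : 1 ≤ k) (hc : 0 ≤ c)
    (hρ : 0 ≤ ρ) (Γ : Sketch) (j : ℕ) : ∃ Γ', HandleArrival P z A c ρ ε Γ j Γ' := by
  obtain ⟨Γ₁, hΓ₁⟩ : ∃ Γ₁, InsertItem P (ε * ρ) Γ j Γ₁ := by
    by_cases h : ∃ b ∈ Γ.balls, dist (P.pt j) (P.pt b) ≤ ε * ρ
    · obtain ⟨b, hb, hd⟩ := h
      exact ⟨_, Or.inl ⟨b, hb, hd, rfl⟩⟩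
    · push Not at h
      exact ⟨_, Or.inr ⟨h, rfl⟩⟩
  obtain ⟨i, hi⟩ : ∃ i, IsGreatest
      {i | i ≤ Γ₁.items.card ∧ (A (P.points (newest Γ₁.items i))).2 ≤ 2 * c * ρ} i := by
    have hfin : {i | i ≤ Γ₁.items.card ∧
        (A (P.points (newest Γ₁.items i))).2 ≤ 2 * c * ρ}.Finite :=
      (Set.finite_Iic Γ₁.items.card).subset fun i hi => hi.1
    -- The empty prefix is always accepted, so a largest accepted prefix exists.
    have h0 : opt k z (P.points (newest Γ₁.items 0)) ≤ 0 := by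
      refine (opt_le_outlierDiam hk z _).trans ?_
      refine outlierDiam_points_le (subset_refl _) (Nat.le_add_right _ _) le_rfl ?_
      simp [newest]
    have hne : {i | i ≤ Γ₁.items.card ∧
        (A (P.points (newest Γ₁.items i))).2 ≤ 2 * c * ρ}.Nonempty :=
      ⟨0, Nat.zero_le _, (hA _).2.trans ((mul_nonpos_of_nonneg_of_nonpos hc h0).trans
        (by positivity))⟩
    obtain ⟨i, hi, hmax⟩ := hfin.exists_maximal hne
    exact ⟨i, hi, fun m hm => (le_total m i).elim id fun h => hmax hm h⟩
  obtain ⟨balls, rep₂, hd⟩ := exists_distribute P (ε * ρ)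
    (leftoverIn P (ε * ρ) Γ₁ (A (P.points (newest Γ₁.items i))) (newest Γ₁.items i)).toList
    (keptBalls P (ε * ρ) Γ₁ (A (P.points (newest Γ₁.items i))))
    (keptRep P (ε * ρ) Γ₁ (A (P.points (newest Γ₁.items i))) (newest Γ₁.items i))
  exact ⟨⟨_, balls, _, _⟩, Γ₁, i, _, rep₂, hΓ₁, hi, rfl, Finset.nodup_toList _,
    Finset.toList_toFinset _, hd, rfl, rfl⟩

theorem exists_sketchAt [Nonempty X] (hA : A.IsApprox z c) (hk : 1 ≤ k) (hc : 0 ≤ c) (hρ : 0 ≤ ρ)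
    (hW : 0 ≤ W) (ht : 0 ≤ t) : ∃ Γ, SketchAt P z A c ρ ε t Γ := by
  have hpos : ∀ u ∈ P.eventTimes, 0 < u := by
    rintro u ⟨i, hi, rfl | rfl⟩
    · exact P.arr_pos i hi
    · exact add_pos_of_pos_of_nonneg (P.arr_pos i hi) hW
  -- Induction on the number of events up to `t`: a run up to the preceding event is extended by the
  -- last one.
  induction hn : (P.eventTimes ∩ Set.Iic t).ncard using Nat.strong_induction_on generalizing t with
  | _ n ih =>
    have hfin := finite_eventTimes_inter_Iic (P := P) hW t
    rcases (P.eventTimes ∩ Set.Iic t).eq_empty_or_nonempty with he | hne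
    · refine ⟨_, .wait 0 t _ .start ht fun u hu hut => ?_⟩
      exact (he ▸ (⟨hu, hut.2⟩ : u ∈ P.eventTimes ∩ Set.Iic t) : u ∈ (∅ : Set ℝ))
    obtain ⟨u, ⟨hu, hut⟩, hmax⟩ := Set.exists_max_image _ id hfin hne
    -- the last event strictly before `u`
    obtain ⟨s, hs0, hsu, hs⟩ : ∃ s, 0 ≤ s ∧ s < u ∧ ∀ v ∈ P.eventTimes, v ∉ Set.Ioo s u := by
      rcases (P.eventTimes ∩ Set.Iio u).eq_empty_or_nonempty with he' | hne'
      · refine ⟨0, le_rfl, hpos u hu, fun v hv hvu => ?_⟩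
        exact (he' ▸ (⟨hv, hvu.2⟩ : v ∈ P.eventTimes ∩ Set.Iio u) : v ∈ (∅ : Set ℝ))
      · have hfin' : (P.eventTimes ∩ Set.Iio u).Finite :=
          hfin.subset fun v hv => ⟨hv.1, (lt_of_lt_of_le (Set.mem_Iio.mp hv.2) hut).le⟩
        obtain ⟨s, ⟨hs, hsu⟩, hmax'⟩ := Set.exists_max_image _ id hfin' hne'
        exact ⟨s, (hpos s hs).le, hsu, fun v hv hvu =>
          absurd (hmax' v ⟨hv, hvu.2⟩) (not_le.mpr hvu.1)⟩
    have hlt : (P.eventTimes ∩ Set.Iic s).ncard < n := by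
      rw [← hn]
      refine Set.ncard_lt_ncard ⟨fun v hv => ⟨hv.1, hv.2.trans (hsu.le.trans hut)⟩, fun h => ?_⟩ hfin
      exact absurd (h ⟨hu, hut⟩).2 (not_le.mpr hsu)
    obtain ⟨Γ, hΓ⟩ := ih _ hlt hs0 rfl
    have hwait : ∀ v ∈ P.eventTimes, v ∉ Set.Ioc u t := fun v hv hvu =>
      absurd (hmax v ⟨hv, hvu.2⟩) (not_le.mpr hvu.1)
    obtain ⟨j, hj, rfl | rfl⟩ := hu
    · obtain ⟨Γ', hΓ'⟩ := exists_handleArrival (P := P) (ε := ε) hA hk hc hρ Γ j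
      exact ⟨Γ', .wait _ _ _ (.arrive s Γ Γ' j hΓ hj hsu hs hΓ') hut hwait⟩
    · exact ⟨_, .wait _ _ _ (.depart s Γ j hΓ hj hsu hs) hut hwait⟩

end Existence

/-! ### Storage and reported answers -/

section Reporting

variable {X : Type*} [MetricSpace X] {W : ℝ} {P : PointStream X W} {k z : ℕ} {A : Solver X k}
  {c ρ ε s t d Δmin Δmax : ℝ} {Γ : Sketch}

theorem storage_le [Nonempty X] (hX : HasDoublingDim X d) (hk : 1 ≤ k) (hc : 1 ≤ c) (hρ : 0 < ρ)
    (hε : 0 < ε) (hε1 : ε < 1) {V : Finset ℕ} (hr : Represents P z (ε / 2 * ρ) V Γ)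
    (hb : SizeBounds P k z (2 * c * ρ + ε / 2 * ρ) Γ) :
    (Γ.storage : ℝ) ≤ (1 + 2 * (16 * c + 8) ^ d) * (k * (z + 1) / ε ^ d) := by
  classical
  have hd := hX.nonneg
  obtain ⟨center, hcen⟩ := hb.centers
  have hs : 0 < ε / 2 * ρ := by positivity
  -- The packing bound for centers within `2 * c * ρ + ε / 2 * ρ` and separation `ε / 2 * ρ`; the
  -- base equals `(16 * c + 4 * ε) / ε`.
  have hN : (4 * (2 * c * ρ + ε / 2 * ρ) / (ε / 2 * ρ)) ^ d ≤ (16 * c + 8) ^ d / ε ^ d := by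
    rw [← Real.div_rpow (by positivity) hε.le]
    refine Real.rpow_le_rpow (by positivity) ?_ hd
    have : 4 * (2 * c * ρ + ε / 2 * ρ) / (ε / 2 * ρ) = (16 * c + 4 * ε) / ε := by
      field_simp; ring
    rw [this]
    gcongr
    linarith
  have hballs : (Γ.balls.card : ℝ) ≤ k * ((16 * c + 8) ^ d / ε ^ d) := by
    have hsub : Γ.balls ⊆ Finset.univ.biUnion fun l : Fin k =>
        Γ.balls.filter fun b => dist (P.pt b) (center l) ≤ 2 * c * ρ + ε / 2 * ρ := by
      intro b hb
      obtain ⟨l, hl⟩ := hcen b hb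
      exact Finset.mem_biUnion.mpr ⟨l, Finset.mem_univ _, Finset.mem_filter.mpr ⟨hb, hl⟩⟩
    calc (Γ.balls.card : ℝ) ≤ ∑ l : Fin k, ((Γ.balls.filter fun b =>
          dist (P.pt b) (center l) ≤ 2 * c * ρ + ε / 2 * ρ).card : ℝ) := by
            exact_mod_cast (Finset.card_le_card hsub).trans Finset.card_biUnion_le
      _ ≤ ∑ _l : Fin k, (16 * c + 8) ^ d / ε ^ d := by
        refine Finset.sum_le_sum fun l _ => (hX.card_le_of_separated hs ?_
          (fun b hb => (Finset.mem_filter.mp hb).2) fun b hb b' hb' => hr.separated b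
            (Finset.mem_filter.mp hb).1 b' (Finset.mem_filter.mp hb').1).trans hN
        have : 0 ≤ 2 * c * ρ := by positivity
        linarith
      _ = _ := by simp
  have hst : Γ.storage ≤ (z + 1) * (1 + 2 * Γ.balls.card) := by
    have h1 : ∑ b ∈ Γ.balls, (Γ.rep b).card ≤ Γ.balls.card * (z + 1) :=
      Finset.sum_le_card_nsmul _ _ _ hb.card_rep
    have h2 := hb.card_out
    have h3 : Γ.balls.card ≤ Γ.balls.card * (z + 1) := Nat.le_mul_of_pos_right _ z.succ_pos
    rw [Sketch.storage]
    linarith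
  have h1 : 1 ≤ k * (1 / ε ^ d) := by
    have h2 : ε ^ d ≤ 1 := Real.rpow_le_one hε.le hε1.le hd
    have h3 : 1 ≤ 1 / ε ^ d := by rw [le_div_iff₀ (by positivity)]; linarith
    have h4 : (1 : ℝ) ≤ k := by exact_mod_cast hk
    nlinarith
  calc (Γ.storage : ℝ) ≤ (z + 1) * (1 + 2 * Γ.balls.card) := by exact_mod_cast hst
    _ ≤ (z + 1) * (k * (1 / ε ^ d) + 2 * (k * ((16 * c + 8) ^ d / ε ^ d))) := by gcongr
    _ = _ := by ring

theorem Represents.exists_near (h : Represents P z s (P.windowItems t) Γ) (hτ : Γ.τ ≤ t) {p : ℕ}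
    (hp : p ∈ P.windowItems t) (hpi : p ∉ Γ.items) :
    ∃ S ⊆ Γ.items, z < S.card ∧ ∀ q ∈ S, dist (P.pt p) (P.pt q) ≤ 2 * s := by
  rcases h.covered p hp with hi | he | ⟨b, hb, hd, hc, -⟩
  · exact absurd hi hpi
  · exact absurd (he.trans hτ) (not_le.mpr (mem_windowItems.mp hp).2.2)
  · exact ⟨Γ.rep b, fun q hq => mem_items.mpr (Or.inr ⟨b, hb, hq⟩), hc, fun q hq => by
      linarith [dist_triangle_right (P.pt p) (P.pt q) (P.pt b), h.dist_le b hb q hq]⟩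

/-- Some stored point near an unstored one is covered, so every item uncovered at radius `r + δ` is
itself a stored outlier. The slack `δ` is `2 * s` in general, but `0` when `2 * s` is below the
minimum distance. -/
theorem Represents.isSolution_window (h : Represents P z s (P.windowItems t) Γ) (hτ : Γ.τ ≤ t)
    {k' : ℕ} {center : Fin k' → X} {r δ : ℝ} (hδ : 0 ≤ δ)
    (hsδ : ∀ p ∈ P.windowItems t, ∀ q ∈ P.windowItems t, dist (P.pt p) (P.pt q) ≤ 2 * s →
      dist (P.pt p) (P.pt q) ≤ δ)
    (hsol : IsSolution z (P.points Γ.items) center r) :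
    IsSolution z (P.window t) center (r + δ) := by
  rw [isSolution_points_iff] at hsol
  refine isSolution_points_iff.mpr ⟨add_nonneg hsol.1 hδ, ?_⟩
  refine (Finset.card_le_card fun p hp => ?_).trans hsol.2
  obtain ⟨hp, hn⟩ := mem_uncovered.mp hp
  have hpi : p ∈ Γ.items := by
    by_contra hpi
    obtain ⟨S, hS, hc, hd⟩ := h.exists_near hτ hp hpi
    have : ¬ S ⊆ uncovered P Γ.items center r := fun hsub =>
      absurd ((Finset.card_le_card hsub).trans hsol.2) (not_le.mpr hc)
    obtain ⟨q, hq, hqu⟩ := Finset.not_subset.mp this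
    rw [mem_uncovered, not_and, not_not] at hqu
    obtain ⟨l, hl⟩ := hqu (hS hq)
    refine hn ⟨l, ?_⟩
    linarith [dist_triangle (P.pt p) (P.pt q) (center l),
      hsδ p hp q (h.items_subset (hS hq)) (hd q hq)]
  exact mem_uncovered.mpr ⟨hpi, fun ⟨l, hl⟩ => hn ⟨l, hl.trans (le_add_of_nonneg_right hδ)⟩⟩

/-- Adding all unstored items to an optimal inlier set `F` of the stored ones deletes no more items
than before. As `F` misses at most `z` stored items, each added item is within `2 * s` of `F`, which
costs `2 * s` at either end. -/
theorem Represents.outlierDiam_window_le (h : Represents P z s (P.windowItems t) Γ) (hτ : Γ.τ ≤ t)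
    (hs : 0 ≤ s) :
    outlierDiam z (P.window t) ≤ outlierDiam z (P.points Γ.items) + 4 * s := by
  obtain ⟨F, hF, hc, hd⟩ := exists_items_dist_le_outlierDiam (P := P) z Γ.items
  have hcard := Finset.card_sdiff_add_card_eq_card hF
  have hnear : ∀ p ∈ F ∪ (P.windowItems t \ Γ.items), ∃ q ∈ F, dist (P.pt p) (P.pt q) ≤ 2 * s := by
    intro p hp
    rcases Finset.mem_union.mp hp with hp | hp
    · exact ⟨p, hp, by rw [dist_self]; positivity⟩
    · obtain ⟨hp, hpi⟩ := Finset.mem_sdiff.mp hp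
      obtain ⟨S, hS, hSc, hSd⟩ := h.exists_near hτ hp hpi
      have : ¬ S ⊆ Γ.items \ F := fun hsub => by
        have := Finset.card_le_card hsub
        omega
      obtain ⟨q, hq, hqn⟩ := Finset.not_subset.mp this
      rw [Finset.mem_sdiff, not_and_not_right] at hqn
      exact ⟨q, hqn (hS hq), hSd q hq⟩
  refine outlierDiam_points_le (F := F ∪ (P.windowItems t \ Γ.items))
    (Finset.union_subset (hF.trans h.items_subset) Finset.sdiff_subset) ?_
    (add_nonneg (outlierDiam_nonneg _ _) (by positivity)) fun i hi j hj => ?_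
  · rw [Finset.card_union_of_disjoint (Finset.disjoint_sdiff.mono_left hF)]
    have := Finset.card_sdiff_add_card_eq_card h.items_subset
    omega
  · obtain ⟨i', hi', hdi⟩ := hnear i hi
    obtain ⟨j', hj', hdj⟩ := hnear j hj
    linarith [dist_triangle4 (P.pt i) (P.pt i') (P.pt j') (P.pt j), hd i' hi' j' hj',
      dist_comm (P.pt j) (P.pt j')]

theorem exists_findSome?_finRange {n : ℕ} {α : Type*} {f : Fin n → Option α}
    (h : ∃ i, f i ≠ none) :
    ∃ i a, (List.finRange n).findSome? f = some a ∧ f i = some a ∧ ∀ j < i, f j = none := by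
  obtain ⟨a, ha⟩ : ∃ a, (List.finRange n).findSome? f = some a := by
    rw [← Option.ne_none_iff_exists']
    obtain ⟨i, hi⟩ := h
    exact fun hn => hi (List.findSome?_eq_none_iff.mp hn i (List.mem_finRange i))
  obtain ⟨l₁, i, l₂, hl, hi, hl₁⟩ := List.findSome?_eq_some_iff.mp ha
  refine ⟨i, a, ha, hi, fun j hji => hl₁ j ?_⟩
  have hp := List.pairwise_lt_finRange n
  rw [hl, List.pairwise_append, List.pairwise_cons] at hp
  have hj := List.mem_finRange j
  rw [hl, List.mem_append, List.mem_cons] at hj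
  rcases hj with hj | rfl | hj
  · exact hj
  · exact absurd hji (lt_irrefl _)
  · exact absurd hji (hp.2.1.1 j hj).asymm

theorem levels_le (h0 : 0 < Δmin) (h : Δmin ≤ Δmax) :
    (levels Δmin Δmax : ℝ) ≤ 1 + Real.logb 2 (Δmax / Δmin) := by
  have : 0 ≤ Real.logb 2 (Δmax / Δmin) := Real.logb_nonneg one_lt_two ((one_le_div₀ h0).mpr h)
  rw [levels, Nat.cast_add, Nat.cast_one, add_comm]
  linarith [Nat.floor_le this]

theorem exists_level (h0 : 0 < Δmin) (h : Δmin ≤ Δmax) :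
    ∃ i : Fin (levels Δmin Δmax), Δmax ≤ 2 * (2 ^ (i : ℕ) * Δmin) := by
  refine ⟨⟨⌊Real.logb 2 (Δmax / Δmin)⌋₊, Nat.lt_succ_self _⟩, ?_⟩
  have h1 := (Nat.lt_floor_add_one (Real.logb 2 (Δmax / Δmin))).le
  rw [Real.logb_le_iff_le_rpow one_lt_two (div_pos (h0.trans_le h) h0), div_le_iff₀ h0] at h1
  rw [← mul_assoc, ← pow_succ']
  exact_mod_cast h1

variable {n : ℕ} {Γs : Fin n → Sketch}

/-- Either the first level is reached, or the previous level is at half the scale. -/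
theorem eq_zero_or_exists_prev (i : Fin n) :
    (i : ℕ) = 0 ∨ ∃ j < i, ∀ x : ℝ, (2 : ℝ) ^ (i : ℕ) * x = 2 * (2 ^ (j : ℕ) * x) := by
  rcases Nat.eq_zero_or_pos (i : ℕ) with h | h
  · exact Or.inl h
  · refine Or.inr ⟨⟨i - 1, by omega⟩, Fin.lt_def.mpr (by simp only; omega), fun x => ?_⟩
    rw [← mul_assoc, ← pow_succ']
    congr 2
    simp only
    omega

theorem TimestampJustified.le_time [Nonempty X] (hk : 1 ≤ k) (hΔ : 0 ≤ Δmax)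
    (hP : P.DistBounds Δmin Δmax) (ht : 0 ≤ t) (hρ : Δmax ≤ 2 * ρ) {τ : ℝ}
    (h : TimestampJustified P k z ρ t τ) : τ ≤ t := by
  by_contra! hlt
  have h1 := h.lt_opt_window hk ht hlt
  have h2 : opt k z (P.window t) ≤ Δmax := opt_le_of_distBounds hk hΔ hP windowItems_lt_len
  linarith

theorem findDiameter_spec [Nonempty X] (hk : 1 ≤ k) (hε : 0 < ε) (hmin : 0 < Δmin)
    (hmax : 0 ≤ Δmax) (hP : P.DistBounds Δmin Δmax) (ht : 0 ≤ t)
    (hlast : ∃ i : Fin n, Δmax ≤ 2 * (2 ^ (i : ℕ) * Δmin))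
    (hrep : ∀ i : Fin n, Represents P z (ε / 2 * (2 ^ (i : ℕ) * Δmin)) (P.windowItems t) (Γs i))
    (hτ : ∀ i : Fin n, TimestampJustified P k z (2 ^ (i : ℕ) * Δmin) t (Γs i).τ) :
    ∃ D : ℝ, findDiameter P z Δmin t Γs = some D ∧
      (1 - 2 * ε) * outlierDiam z (P.window t) ≤ D ∧ D ≤ outlierDiam z (P.window t) := by
  have hle : ∀ i, outlierDiam z (P.points (Γs i).items) ≤ outlierDiam z (P.window t) := fun i =>
    outlierDiam_points_mono (hrep i).items_subset
  have hwin : outlierDiam z (P.window t) ≤ Δmax :=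
    outlierDiam_le_of_distBounds hmax hP windowItems_lt_len
  have hex : ∃ i : Fin n, tryDiameter P z (2 ^ (i : ℕ) * Δmin) t (Γs i) ≠ none := by
    obtain ⟨i, hi⟩ := hlast
    refine ⟨i, ?_⟩
    have h1 := (hτ i).le_time hk hmax hP ht hi
    have h2 := (hle i).trans (hwin.trans hi)
    simp [tryDiameter, h1, h2]
  obtain ⟨i, D, hfind, hi, hprev⟩ := exists_findSome?_finRange hex
  refine ⟨D, hfind, ?_⟩
  obtain ⟨hτi, rfl⟩ :
      (Γs i).τ ≤ t ∧ outlierDiam z (P.points (Γs i).items) = D := by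
    simp only [tryDiameter] at hi
    split_ifs at hi with hcond
    push Not at hcond
    exact ⟨hcond.1, Option.some.inj hi⟩
  refine ⟨?_, hle i⟩
  have hpos : 0 ≤ ε / 2 * (2 ^ (i : ℕ) * Δmin) := by positivity
  have happrox := (hrep i).outlierDiam_window_le hτi hpos
  have hnn := outlierDiam_nonneg z (P.window t)
  have hnnD := outlierDiam_nonneg z (P.points (Γs i).items)
  -- The additive error is `4 * (ε / 2) * ρ = 2 * ε * ρ`, so `ρ` must be at most the true diameter.
  -- If the previous level was rejected by its timestamp, this uses that the `k`-center radius is at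
  -- most the diameter.
  have key : outlierDiam z (P.window t) = 0 ∨
      2 ^ (i : ℕ) * Δmin ≤ outlierDiam z (P.window t) := by
    rcases eq_zero_or_exists_prev i with h0 | ⟨j, hj, hscale⟩
    · rw [h0, pow_zero, one_mul]
      refine (lt_or_ge (outlierDiam z (P.window t)) Δmin).imp_left fun hlt => ?_
      exact outlierDiam_eq_zero_of_lt hP windowItems_lt_len hlt
    · right
      rw [hscale]
      have hj := hprev j hj
      simp only [tryDiameter] at hj
      split_ifs at hj with hcond
      rcases hcond with hlt | hlt
      · exact ((hτ j).lt_opt_window hk ht hlt).le.trans (opt_le_outlierDiam hk z _)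
      · exact hlt.le.trans (hle j)
  rcases key with h0 | hge
  · rw [h0, mul_zero]; exact hnnD
  · nlinarith

theorem findApproximateCenters_spec [Nonempty X] {k' : ℕ} (hk' : 1 ≤ k') (hkk : k' ≤ k)
    (hε : 0 < ε) (hε1 : ε < 1)
    (hmin : 0 < Δmin) (hmax : 0 ≤ Δmax) (hP : P.DistBounds Δmin Δmax)
    (hsep : P.CentersSeparated Δmin) (ht : 0 ≤ t)
    (hlast : ∃ i : Fin n, Δmax ≤ 2 * (2 ^ (i : ℕ) * Δmin))
    (hrep : ∀ i : Fin n, Represents P z (ε / 2 * (2 ^ (i : ℕ) * Δmin)) (P.windowItems t) (Γs i))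
    (hτ : ∀ i : Fin n, TimestampJustified P k z (2 ^ (i : ℕ) * Δmin) t (Γs i).τ)
    {solve : Solver X k'} (hsolve : solve.IsApprox z 1) :
    ∃ (center : Fin k' → X) (r : ℝ),
      findApproximateCenters P solve Δmin ε t Γs = some (center, r) ∧
      IsSolution z (P.window t) center r ∧ r ≤ (1 + ε) * opt k' z (P.window t) := by
  have hradius : ∀ Q, (solve Q).2 = opt k' z Q := fun Q =>
    le_antisymm (by simpa using (hsolve Q).2) (hsolve Q).1.opt_le
  have hle : ∀ i, opt k' z (P.points (Γs i).items) ≤ opt k' z (P.window t) := fun i =>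
    opt_points_mono hk' (hrep i).items_subset
  have hwin : opt k' z (P.window t) ≤ Δmax :=
    opt_le_of_distBounds hk' hmax hP windowItems_lt_len
  have hnn := opt_nonneg k' z (P.window t)
  have hex : ∃ i : Fin n, tryToCover P solve (2 ^ (i : ℕ) * Δmin) (ε / 2) t (Γs i) ≠ none := by
    obtain ⟨i, hi⟩ := hlast
    refine ⟨i, ?_⟩
    have h1 := (hτ i).le_time (hk'.trans hkk) hmax hP ht hi
    have h2 := (hle i).trans (hwin.trans hi)
    simp [tryToCover, h1, h2, hradius]
  obtain ⟨i, ans, hfind, hi, hprev⟩ := exists_findSome?_finRange hex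
  simp only [tryToCover] at hi
  split_ifs at hi with hcond
  push Not at hcond
  obtain rfl := Option.some.inj hi
  set Q := P.points (Γs i).items with hQ
  have hρ : 0 < 2 ^ (i : ℕ) * Δmin := by positivity
  have hnnQ := opt_nonneg k' z Q
  have hfind' : findApproximateCenters P solve Δmin ε t Γs = some
      (if (solve Q).2 + 2 * (ε / 2) * (2 ^ (i : ℕ) * Δmin) < Δmin then ((solve Q).1, 0)
        else ((solve Q).1, (solve Q).2 + 2 * (ε / 2) * (2 ^ (i : ℕ) * Δmin))) := by
    rw [findApproximateCenters, hfind]; rfl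
  have hlen : ∀ q ∈ (Γs i).items, (q : ℕ∞) < P.len := fun q hq =>
    windowItems_lt_len q ((hrep i).items_subset hq)
  by_cases hlt : (solve Q).2 + 2 * (ε / 2) * (2 ^ (i : ℕ) * Δmin) < Δmin
  · rw [if_pos hlt] at hfind'
    refine ⟨_, _, hfind', ?_, by positivity⟩
    -- Both the optimum of the stored points and the additive error are below `Δmin`. Hence the
    -- former vanishes, and unstored points coincide with the stored points near them, so no slack
    -- is needed.
    have h0 : (solve Q).2 = 0 := by
      rw [hradius] at hlt ⊢
      refine opt_eq_zero_of_lt hk' hsep hlen ?_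
      nlinarith
    rw [h0, zero_add] at hlt
    have hsol := (hsolve Q).1
    rw [h0] at hsol
    have := (hrep i).isSolution_window hcond.1 le_rfl (fun p hp q hq hpq => ?_) hsol
    · simpa using this
    · by_contra! hpos
      have := (hP p q (windowItems_lt_len p hp) (windowItems_lt_len q hq)).1 (dist_pos.mp hpos)
      linarith
  · rw [if_neg hlt] at hfind'
    refine ⟨_, _, hfind', ?_, ?_⟩
    · have := (hrep i).isSolution_window hcond.1
        (δ := 2 * (ε / 2) * (2 ^ (i : ℕ) * Δmin)) (by positivity)
        (fun p hp q hq hpq => by linarith) (hsolve Q).1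
      exact this
    · rw [hradius] at hlt ⊢
      have hge : 2 ^ (i : ℕ) * Δmin ≤ opt k' z (P.window t) := by
        rcases eq_zero_or_exists_prev i with h0 | ⟨j, hj, hscale⟩
        · rw [h0, pow_zero, one_mul] at hlt ⊢
          -- Otherwise the optimum is zero and the reported radius is at most `ε * Δmin < Δmin`,
          -- which the other case covers.
          by_contra! hopt
          have hz : opt k' z (P.window t) = 0 :=
            opt_eq_zero_of_lt hk' hsep windowItems_lt_len hopt
          have := hle i
          nlinarith
        · rw [hscale]
          have hj := hprev j hj
          simp only [tryToCover] at hj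
          split_ifs at hj with hcond
          rcases hcond with hlt | hlt
          · exact ((hτ j).lt_opt_window (hk'.trans hkk) ht hlt).le.trans (opt_anti hk' hkk _)
          · rw [hradius] at hlt
            exact hlt.le.trans (hle j)
      have := hle i
      nlinarith

end Reporting

/-- The guarantees of the `k`-center sketch, with the constant `1 + 2 * (16 * c + 8) ^ d`. -/
theorem fullSketch_spec {X : Type*} [MetricSpace X] {d c : ℝ} (hc : 1 ≤ c)
    (hX : HasDoublingDim X d) {k z : ℕ} {A : Solver X k} (hk : 1 ≤ k) (hA : A.IsApprox z c)
    {ε Δmin Δmax W : ℝ} (hε : 0 < ε) (hε1 : ε < 1) (hmin : 0 < Δmin) (hmm : Δmin ≤ Δmax)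
    (hW : 0 < W) {P : PointStream X W} (hP : P.DistBounds Δmin Δmax) {t : ℝ} (ht : 0 ≤ t) :
    (∃ Γ, IsFullSketch P z A c Δmin Δmax ε t Γ) ∧
    ∀ Γ, IsFullSketch P z A c Δmin Δmax ε t Γ →
      (totalStorage Γ : ℝ) ≤ (1 + 2 * (16 * c + 8) ^ d) * (k * (z + 1) / ε ^ d) *
        (1 + Real.logb 2 (Δmax / Δmin)) ∧
      (P.CentersSeparated Δmin →
        ∀ k' : ℕ, 1 ≤ k' → k' ≤ k → ∀ solve : Solver X k', solve.IsApprox z 1 →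
          ∃ (center : Fin k' → X) (r : ℝ),
            findApproximateCenters P solve Δmin ε t Γ = some (center, r) ∧
            IsSolution z (P.window t) center r ∧
            r ≤ (1 + ε) * opt k' z (P.window t)) ∧
      (∃ D : ℝ, findDiameter P z Δmin t Γ = some D ∧
        (1 - 2 * ε) * outlierDiam z (P.window t) ≤ D ∧
        D ≤ outlierDiam z (P.window t)) := by
  -- The solver reports at least one center even on the empty multiset.
  have : Nonempty X := ⟨(A 0).1 ⟨0, hk⟩⟩
  have hc0 : 0 < c := by linarith
  have hmax : 0 ≤ Δmax := hmin.le.trans hmm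
  refine ⟨?_, fun Γ hΓ => ?_⟩
  · choose Γ hΓ using fun i : Fin (levels Δmin Δmax) =>
      exists_sketchAt (P := P) (ε := ε / 2) (ρ := 2 ^ (i : ℕ) * Δmin) hA hk hc0.le (by positivity)
        hW.le ht
    exact ⟨Γ, hΓ⟩
  · have hinv := fun i => (hΓ i).invariant hA hc (by positivity) hW
    have hlast := exists_level hmin hmm
    refine ⟨?_, fun hsep k' hk' hkk solve hsolve => ?_, ?_⟩
    · have hst := fun i => storage_le hX hk hc (by positivity) hε hε1 (hinv i).1 (hinv i).2.1
      calc (totalStorage Γ : ℝ) = ∑ i, ((Γ i).storage : ℝ) := by rw [totalStorage]; push_cast; rfl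
        _ ≤ ∑ _i : Fin (levels Δmin Δmax), (1 + 2 * (16 * c + 8) ^ d) * (k * (z + 1) / ε ^ d) :=
          Finset.sum_le_sum fun i _ => hst i
        _ = (1 + 2 * (16 * c + 8) ^ d) * (k * (z + 1) / ε ^ d) * levels Δmin Δmax := by
          rw [Finset.sum_const, Finset.card_univ, Fintype.card_fin, nsmul_eq_mul, mul_comm]
        _ ≤ _ := by
          gcongr
          exact levels_le hmin hmm
    · exact findApproximateCenters_spec hk' hkk hε hε1 hmin hmax hP hsep ht hlast
        (fun i => (hinv i).1) (fun i => (hinv i).2.2) hsolve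
    · exact findDiameter_spec hk hε hmin hmax hP ht hlast (fun i => (hinv i).1)
        (fun i => (hinv i).2.2)

end SlidingWindow

theorem theorem2 :
    -- the sketch for the `k`-center problem with `z` outliers
    (∀ d c : ℝ, 1 ≤ c → ∃ C : ℝ, 0 < C ∧
      ∀ (X : Type*) [MetricSpace X], HasDoublingDim X d →
      ∀ (k z : ℕ) (A : Solver X k), 1 ≤ k → A.IsApprox z c →
      ∀ ε Δmin Δmax W : ℝ, 0 < ε → ε < 1 → 0 < Δmin → Δmin ≤ Δmax → 0 < W →
      ∀ P : PointStream X W, P.DistBounds Δmin Δmax → ∀ t : ℝ, 0 ≤ t →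
        (∃ Γ, IsFullSketch P z A c Δmin Δmax ε t Γ) ∧
        ∀ Γ, IsFullSketch P z A c Δmin Δmax ε t Γ →
          -- the storage bound
          (totalStorage Γ : ℝ) ≤ C * (k * (z + 1) / ε ^ d) * (1 + Real.logb 2 (Δmax / Δmin)) ∧
          -- it gives a `(1 + ε)`-approximation for the `k'`-center problem with outliers
          (P.CentersSeparated Δmin →
            ∀ k' : ℕ, 1 ≤ k' → k' ≤ k → ∀ solve : Solver X k', solve.IsApprox z 1 →
              ∃ (center : Fin k' → X) (r : ℝ),
                findApproximateCenters P solve Δmin ε t Γ = some (center, r) ∧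
                IsSolution z (P.window t) center r ∧
                r ≤ (1 + ε) * opt k' z (P.window t)) ∧
          -- it gives a `(1 - 2 * ε)`-approximation for the diameter with outliers
          (∃ D : ℝ, findDiameter P z Δmin t Γ = some D ∧
            (1 - 2 * ε) * outlierDiam z (P.window t) ≤ D ∧
            D ≤ outlierDiam z (P.window t))) ∧
    -- the `1`-center sketch as a sketch for the diameter with outliers
    (∀ d : ℝ, ∃ C : ℝ, 0 < C ∧
      ∀ (X : Type*) [MetricSpace X] [Nonempty X], HasDoublingDim X d →
      ∀ z : ℕ, ∃ A : Solver X 1, A.IsApprox z 3 ∧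
      ∀ ε Δmin Δmax W : ℝ, 0 < ε → ε < 1 → 0 < Δmin → Δmin ≤ Δmax → 0 < W →
      ∀ P : PointStream X W, P.DistBounds Δmin Δmax → ∀ t : ℝ, 0 ≤ t →
        (∃ Γ, IsFullSketch P z A 3 Δmin Δmax (ε / 4) t Γ) ∧
        ∀ Γ, IsFullSketch P z A 3 Δmin Δmax (ε / 4) t Γ →
          (totalStorage Γ : ℝ) ≤ C * ((z + 1) / ε ^ d) * (1 + Real.logb 2 (Δmax / Δmin)) ∧
          ∃ D : ℝ, findDiameter P z Δmin t Γ = some D ∧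
            D ≤ outlierDiam z (P.window t) ∧ outlierDiam z (P.window t) ≤ (1 + ε) * D) := by
  refine ⟨fun d c hc => ⟨1 + 2 * (16 * c + 8) ^ d, by positivity, ?_⟩,
    fun d => ⟨(1 + 2 * (16 * 3 + 8) ^ d) * 4 ^ d, by positivity, ?_⟩⟩
  · intro X _ hX k z A hk hA ε Δmin Δmax W hε hε1 hmin hmm hW P hP t ht
    exact fullSketch_spec hc hX hk hA hε hε1 hmin hmm hW hP ht
  · intro X _ _ hX z
    obtain ⟨A, hA⟩ := exists_solver_isApprox (X := X) z
    refine ⟨A, hA, fun ε Δmin Δmax W hε hε1 hmin hmm hW P hP t ht => ?_⟩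
    obtain ⟨hex, hall⟩ := fullSketch_spec (ε := ε / 4) (by norm_num) hX le_rfl hA (by linarith)
      (by linarith) hmin hmm hW hP ht
    refine ⟨hex, fun Γ hΓ => ?_⟩
    obtain ⟨hst, -, D, hD, hlow, hup⟩ := hall Γ hΓ
    refine ⟨hst.trans_eq ?_, D, hD, hup, ?_⟩
    -- The factor `4 ^ d` in the constant comes from running the sketch with `ε / 4`.
    · rw [Real.div_rpow hε.le (by norm_num)]
      have : (0 : ℝ) < 4 ^ d := by positivity
      push_cast
      field_simp
    · have hnn := outlierDiam_nonneg z (P.window t)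
      have h1 : (1 + ε) * ((1 - 2 * (ε / 4)) * outlierDiam z (P.window t)) ≤ (1 + ε) * D :=
        mul_le_mul_of_nonneg_left hlow (by linarith)
      -- This is `(1 + ε) * (1 - ε / 2) = 1 + ε * (1 - ε) / 2 ≥ 1`.
      nlinarith [mul_nonneg (mul_nonneg hε.le (sub_nonneg.mpr hε1.le)) hnn]
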